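/- For a finite graph $G$ on a vertex set $V$ with nonnegative edge weights $w$ (all equal to $1$ if $G$ is unweighted), the weighted degree of a vertex is the sum of the weights of its incident edges, and the edge expansion of $G$ is $$\phi(G)=\min\Big\{\frac{w(S,\bar S)}{|S|} : S\subset V,\ 0<|S|\le |V|/2\Big\},$$ where $w(S,\bar S)$ is the total weight of the edges with exactly one endpoint in $S$. There is an absolute constant $C>0$ such that for all $\beta,\gamma>0$ there is $n_0=n_0(\beta,\gamma)$ with the following property. Let $n\ge n_0$ and let $G$ be an unweighted simple $D$-regular graph on $n$ vertices with $D\ge\beta n$ and $\phi(G)\ge\gamma D$. Then $G$ contains a subgraph $H$ on the same vertex set, with edge weights in $\{1,2\}$, such that all weighted degrees of $H$ are equal to one integer $d\le(\log n)^{C/(\beta\gamma^2)}$ and $\phi(H)\ge\frac13$. Moreover, such an $H$ can be found in randomized polynomial time: for all fixed $\beta,\gamma>0$ there are a randomized algorithm and a polynomial $T$ such that, for all $n\ge n_0$ and all $G$ as above, the algorithm on input $G$ always halts within $T(n)$ steps and with probability at least $1-\frac1n$ outputs an $H$ as above. -/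

import Mathlib

/-- A finite weighted undirected graph without loops, given by its symmetric weight function;
a pair of weight `0` is a non-edge. -/
structure WeightedGraph (V : Type*) where
  weight : V → V → ℝ
  nonneg : ∀ u v, 0 ≤ weight u v
  symm : ∀ u v, weight u v = weight v u
  loopless : ∀ v, weight v v = 0

namespace WeightedGraph

variable {V : Type*}

open Classical in
/-- An unweighted graph, seen as a weighted graph all of whose edges have weight `1`. -/
noncomputable def ofSimpleGraph (G : SimpleGraph V) : WeightedGraph V where
  weight u v := if G.Adj u v then 1 else 0
  nonneg u v := by split_ifs <;> norm_num
  symm u v := by simp only [G.adj_comm]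
  loopless v := by simp

/-- `H` is a subgraph of the unweighted graph `G` on the same vertex set, with edge weights
of its own. -/
def IsSubgraphOf (H : WeightedGraph V) (G : SimpleGraph V) : Prop :=
  ∀ u v, H.weight u v ≠ 0 → G.Adj u v

/-- Every edge has weight `1` or `2`. -/
def HasWeightsOneTwo (H : WeightedGraph V) : Prop :=
  ∀ u v, H.weight u v ≠ 0 → H.weight u v = 1 ∨ H.weight u v = 2

variable [Fintype V]

/-- All weighted degrees are equal to `d`. -/
def IsRegular (H : WeightedGraph V) (d : ℝ) : Prop :=
  ∀ v, ∑ u, H.weight v u = d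

variable [DecidableEq V]

/-- The total weight of the edges with exactly one endpoint in `S`. -/
def cutWeight (H : WeightedGraph V) (S : Finset V) : ℝ :=
  ∑ u ∈ S, ∑ v ∈ Sᶜ, H.weight u v

/-- The edge expansion `φ(H)`, the minimum of `w(S, Sᶜ) / |S|` over all `S` with
`0 < |S| ≤ |V| / 2`. (For `|V| ≥ 2` this is the infimum of a finite non-empty set.) -/
noncomputable def edgeExpansion (H : WeightedGraph V) : ℝ :=
  sInf {x : ℝ | ∃ S : Finset V, 0 < S.card ∧ 2 * S.card ≤ Fintype.card V ∧
    x = H.cutWeight S / S.card}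

end WeightedGraph

open Classical in
/-- `G` is `D`-regular for some `D ≥ β n` and satisfies `φ(G) ≥ γ D`. -/
def IsDenseRegularExpander (β γ : ℝ) {n : ℕ} (G : SimpleGraph (Fin n)) : Prop :=
  ∃ D : ℕ, G.IsRegularOfDegree D ∧ β * n ≤ D ∧
    γ * D ≤ (WeightedGraph.ofSimpleGraph G).edgeExpansion

/-- `H` is a subgraph of `G` with edge weights in `{1, 2}`, it is regular of some weighted degree
`d ≤ s`, and `φ(H) ≥ 1/3`. -/
def IsSparseExpandingSubgraph (s : ℝ) {n : ℕ} (G : SimpleGraph (Fin n))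
    (H : WeightedGraph (Fin n)) : Prop :=
  H.IsSubgraphOf G ∧ H.HasWeightsOneTwo ∧
    (∃ d : ℕ, H.IsRegular d ∧ (d : ℝ) ≤ s) ∧ 1 / 3 ≤ H.edgeExpansion

/-! ### Randomized random access machines

Structured programs for a random access machine that can toss coins. A program has finitely many
variables and finitely many two-dimensional arrays (all named by natural numbers), which hold
natural numbers. The arithmetic operations are addition and truncated subtraction, so that in `t`
steps the bit length of the stored numbers grows by `O(t)` only, and the unit cost measure used here
is polynomially related to the running time of a probabilistic Turing machine. -/

namespace RAM

/-- Expressions: constants, variables, sum, truncated difference, and array entries `a[i][j]`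
(the name `a` of the array is fixed in the program). -/
inductive Expr where
  | const (k : ℕ)
  | var (x : ℕ)
  | add (e₁ e₂ : Expr)
  | sub (e₁ e₂ : Expr)
  | load (a : ℕ) (i j : Expr)

/-- Programs. -/
inductive Prog where
  | skip
  | assign (x : ℕ) (e : Expr)
  | store (a : ℕ) (i j e : Expr)
  | flip (x : ℕ)
  | seq (p q : Prog)
  | ifNonzero (e : Expr) (p q : Prog)
  | whileNonzero (e : Expr) (p : Prog)

/-- The contents of the variables and of the arrays, and the number of coins tossed so far. -/
structure State where
  var : ℕ → ℕ
  arr : ℕ → ℕ → ℕ → ℕ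
  tossed : ℕ

/-- The value of an expression. -/
def Expr.eval (s : State) : Expr → ℕ
  | .const k => k
  | .var x => s.var x
  | .add e₁ e₂ => e₁.eval s + e₂.eval s
  | .sub e₁ e₂ => e₁.eval s - e₂.eval s
  | .load a i j => s.arr a (i.eval s) (j.eval s)

/-- The number of steps for evaluating an expression: one for each operation in it. -/
def Expr.cost : Expr → ℕ
  | .const _ => 1
  | .var _ => 1
  | .add e₁ e₂ => e₁.cost + e₂.cost + 1
  | .sub e₁ e₂ => e₁.cost + e₂.cost + 1
  | .load _ i j => i.cost + j.cost + 1

/-- Write `v` into the variable `x`. -/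
def State.setVar (s : State) (x v : ℕ) : State :=
  { s with var := Function.update s.var x v }

/-- Write `v` into the array entry `a[i][j]`. -/
def State.setArr (s : State) (a i j v : ℕ) : State :=
  { s with arr := fun a' i' j' => if a' = a ∧ i' = i ∧ j' = j then v else s.arr a' i' j' }

/-- `Run ω p s t s'`: with the coin sequence `ω`, the program `p` started in the state `s` halts
after `t` steps in the state `s'`. -/
inductive Run (ω : ℕ → Bool) : Prog → State → ℕ → State → Prop where
  | skip (s : State) : Run ω .skip s 1 s
  | assign (s : State) (x : ℕ) (e : Expr) :
      Run ω (.assign x e) s (e.cost + 1) (s.setVar x (e.eval s))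
  | store (s : State) (a : ℕ) (i j e : Expr) :
      Run ω (.store a i j e) s (i.cost + j.cost + e.cost + 1)
        (s.setArr a (i.eval s) (j.eval s) (e.eval s))
  | flip (s : State) (x : ℕ) :
      Run ω (.flip x) s 1
        { s.setVar x (if ω s.tossed then 1 else 0) with tossed := s.tossed + 1 }
  | seq {p q : Prog} {s s' s'' : State} {t t' : ℕ} :
      Run ω p s t s' → Run ω q s' t' s'' → Run ω (.seq p q) s (t + t') s''
  | if_true {e : Expr} {p q : Prog} {s s' : State} {t : ℕ} :
      e.eval s ≠ 0 → Run ω p s t s' → Run ω (.ifNonzero e p q) s (e.cost + 1 + t) s'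
  | if_false {e : Expr} {p q : Prog} {s s' : State} {t : ℕ} :
      e.eval s = 0 → Run ω q s t s' → Run ω (.ifNonzero e p q) s (e.cost + 1 + t) s'
  | while_true {e : Expr} {p : Prog} {s s' s'' : State} {t t' : ℕ} :
      e.eval s ≠ 0 → Run ω p s t s' → Run ω (.whileNonzero e p) s' t' s'' →
        Run ω (.whileNonzero e p) s (e.cost + 1 + t + t') s''
  | while_false {e : Expr} {p : Prog} {s : State} :
      e.eval s = 0 → Run ω (.whileNonzero e p) s (e.cost + 1) s

open Classical in
/-- The initial state on input `G`: variable `0` holds the number of vertices, array `0` holds the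
adjacency matrix, and everything else is `0`. -/
noncomputable def State.input {n : ℕ} (G : SimpleGraph (Fin n)) : State where
  var x := if x = 0 then n else 0
  arr a i j := if a = 0 ∧ ∃ u v : Fin n, u.val = i ∧ v.val = j ∧ G.Adj u v then 1 else 0
  tossed := 0

/-- The weighted graph `H` is the output: array `1` holds its weight matrix. -/
def State.Outputs {n : ℕ} (s : State) (H : WeightedGraph (Fin n)) : Prop :=
  ∀ u v : Fin n, (s.arr 1 u v : ℝ) = H.weight u v

/-- The coin sequence that starts with the `m` coins `r`. -/
def coins {m : ℕ} (r : Fin m → Bool) : ℕ → Bool :=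
  fun i => if h : i < m then r ⟨i, h⟩ else false

open Classical in
/-- A search problem on graphs, with instances the graphs that satisfy `inst` and with valid outputs
given by `good`, is solved in randomized polynomial time: for some program and some polynomial `T`,
on every `n`-vertex instance the program halts within `T(n)` steps whatever the coins are, and with
probability at least `1 - 1/n` over `T(n)` independent fair coins (it cannot use more of them) the
output is valid. -/
def SolvableInRandomizedPolyTime (inst : ∀ n : ℕ, SimpleGraph (Fin n) → Prop)
    (good : ∀ n : ℕ, SimpleGraph (Fin n) → WeightedGraph (Fin n) → Prop) : Prop :=
  ∃ (P : Prog) (T : Polynomial ℕ), ∀ (n : ℕ) (G : SimpleGraph (Fin n)), inst n G →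
    (∀ ω : ℕ → Bool, ∃ (t : ℕ) (s : State), Run ω P (State.input G) t s ∧ t ≤ T.eval n) ∧
    (1 - 1 / (n : ℝ)) * 2 ^ (T.eval n) ≤
      ((Finset.univ.filter fun r : Fin (T.eval n) → Bool =>
        ∃ (t : ℕ) (s : State) (H : WeightedGraph (Fin n)),
          Run (coins r) P (State.input G) t s ∧ s.Outputs H ∧ good n G H).card : ℝ)

end RAM

/-! Let L be the bit length of n, q = L² and k = L³. Keep each ordered pair of adjacent vertices
independently with probability 2^(-b), where b is chosen such that q/(2n) ≤ 2^(-b) ≤ q/n. This gives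
a zero-one matrix R below the adjacency matrix A. If some zero-one M with R ≤ M ≤ A has all line
sums k, then H = M + Mᵀ has edge weights 1 and 2 and all degrees 2k, of order log³ n, hence at most
log⁴ n for large n. The exponent 4 is enough because the hypotheses force β, γ ≤ 1. Expansion comes
from R alone: Chernoff and a union bound over S give R(S, Sᶜ) ≥ |S| for every S with 0 < |S| ≤ n/2
(`sum_card_badSet_le`), so even φ(H) ≥ 1.

By max-flow min-cut, M exists if R(Xᶜ, Y) + k|X| ≤ A(X, Yᶜ) + k|Y| for all X, Y. Regularity gives
A(Xᶜ, Y) - A(X, Yᶜ) = D(|Y| - |X|). If |Y| ≤ |X|, the condition follows from R ≤ A and k ≤ D. If |Y|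
> |X|, a violation needs at least L times the expected number of kept pairs in Xᶜ × Y. Its
probability is exponentially small in k/D times the edge boundary of (X, Y) in the bipartite double
cover of G (`card_badCut_le`). A union bound over all 4^n pairs works because few of them have small
boundary: by expansion of G, each pair is within a distance proportional to its boundary from one of
four fixed pairs, namely the empty one, the full one, a best near-bipartition and its complement
(`SimpleGraph.exists_centers`, `sum_card_badCut_le`). So G may be bipartite or nearly so.

The algorithm draws R and finds M by push–relabel without source or sink. Each of the 2n row and
column vertices keeps k units and passes on the rest. If a vertex is stuck with more than k units at
the top height, a gap in the heights yields a violated cut (`Preflow.Valid.ex_le`). A potential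
argument shows that n⁵ sweeps suffice, so that number is run without a termination test. Existence
of H follows from the positive success probability. -/

namespace RAM

/-! ### Hoare rules with cost bounds -/

@[simp] theorem State.setVar_var (s : State) (x v y : ℕ) :
    (s.setVar x v).var y = if y = x then v else s.var y := by
  simp [State.setVar, Function.update_apply]

@[simp] theorem State.setVar_arr (s : State) (x v : ℕ) : (s.setVar x v).arr = s.arr := rfl

@[simp] theorem State.setVar_tossed (s : State) (x v : ℕ) : (s.setVar x v).tossed = s.tossed := rfl

@[simp] theorem State.setArr_var (s : State) (a i j v : ℕ) : (s.setArr a i j v).var = s.var := rfl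

@[simp] theorem State.setArr_tossed (s : State) (a i j v : ℕ) :
    (s.setArr a i j v).tossed = s.tossed := rfl

@[simp] theorem State.setArr_arr (s : State) (a i j v a' i' j' : ℕ) :
    (s.setArr a i j v).arr a' i' j' = if a' = a ∧ i' = i ∧ j' = j then v else s.arr a' i' j' := rfl

/-- The program never writes into the variable `x`. -/
def Prog.Keeps (x : ℕ) : Prog → Prop
  | .skip => True
  | .assign y _ => x ≠ y
  | .store _ _ _ _ => True
  | .flip y => x ≠ y
  | .seq p q => p.Keeps x ∧ q.Keeps x
  | .ifNonzero _ p q => p.Keeps x ∧ q.Keeps x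
  | .whileNonzero _ p => p.Keeps x

/-- Frame rule: a syntactic check of the written variables replaces bookkeeping, so specifications
need to list only what changes. -/
theorem Run.var_eq {ω : ℕ → Bool} {x : ℕ} {p : Prog} {s s' : State} {t : ℕ}
    (h : Run ω p s t s') (hk : p.Keeps x) : s'.var x = s.var x := by
  induction h with
  | skip => rfl
  | assign s y e => simp only [Prog.Keeps] at hk; simp [hk]
  | store => rfl
  | flip s y => simp only [Prog.Keeps] at hk; simp [hk]
  | seq _ _ ih₁ ih₂ => rw [ih₂ hk.2, ih₁ hk.1]
  | if_true _ _ ih => exact ih hk.1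
  | if_false _ _ ih => exact ih hk.2
  | while_true _ _ _ ih₁ ih₂ => rw [ih₂ hk, ih₁ hk]
  | while_false => rfl

/-- Started in `s`, the program halts within `B` steps in a state that satisfies `Q`. -/
def Ensures (ω : ℕ → Bool) (p : Prog) (s : State) (B : ℕ) (Q : State → Prop) : Prop :=
  ∃ t s', Run ω p s t s' ∧ t ≤ B ∧ Q s'

variable {ω : ℕ → Bool} {p q : Prog} {s : State} {B B' : ℕ} {Q Q' : State → Prop}

theorem Ensures.mono (h : Ensures ω p s B Q) (hB : B ≤ B') (hQ : ∀ s', Q s' → Q' s') :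
    Ensures ω p s B' Q' := by
  obtain ⟨t, s', hr, ht, hq⟩ := h
  exact ⟨t, s', hr, ht.trans hB, hQ _ hq⟩

theorem Ensures.and_keeps (h : Ensures ω p s B Q) :
    Ensures ω p s B (fun s' => Q s' ∧ ∀ x, p.Keeps x → s'.var x = s.var x) := by
  obtain ⟨t, s', hr, ht, hq⟩ := h
  exact ⟨t, s', hr, ht, hq, fun x hx => hr.var_eq hx⟩

theorem Ensures.skip (h : Q s) : Ensures ω .skip s 1 Q := ⟨_, _, .skip s, le_rfl, h⟩

theorem Ensures.assign {x : ℕ} {e : Expr} (h : Q (s.setVar x (e.eval s))) :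
    Ensures ω (.assign x e) s (e.cost + 1) Q := ⟨_, _, .assign s x e, le_rfl, h⟩

theorem Ensures.store {a : ℕ} {i j e : Expr}
    (h : Q (s.setArr a (i.eval s) (j.eval s) (e.eval s))) :
    Ensures ω (.store a i j e) s (i.cost + j.cost + e.cost + 1) Q :=
  ⟨_, _, .store s a i j e, le_rfl, h⟩

theorem Ensures.flip {x : ℕ}
    (h : Q { s.setVar x (if ω s.tossed then 1 else 0) with tossed := s.tossed + 1 }) :
    Ensures ω (.flip x) s 1 Q := ⟨_, _, .flip s x, le_rfl, h⟩

theorem Ensures.seq (h : Ensures ω p s B (fun s' => Ensures ω q s' B' Q)) :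
    Ensures ω (.seq p q) s (B + B') Q := by
  obtain ⟨t, s', hr, ht, t', s'', hr', ht', hq⟩ := h
  exact ⟨_, _, .seq hr hr', add_le_add ht ht', hq⟩

theorem Ensures.ite {e : Expr} (h₁ : e.eval s ≠ 0 → Ensures ω p s B Q)
    (h₂ : e.eval s = 0 → Ensures ω q s B' Q) :
    Ensures ω (.ifNonzero e p q) s (e.cost + 1 + (B + B')) Q := by
  by_cases he : e.eval s = 0
  · obtain ⟨t, s', hr, ht, hq⟩ := h₂ he
    exact ⟨_, _, .if_false he hr, by omega, hq⟩
  · obtain ⟨t, s', hr, ht, hq⟩ := h₁ he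
    exact ⟨_, _, .if_true he hr, by omega, hq⟩

/-- `for x = 0, …, m - 1 do p`, where `m` is the content of the variable `m`. -/
def Prog.forRange (x m : ℕ) (p : Prog) : Prog :=
  .seq (.assign x (.const 0))
    (.whileNonzero (.sub (.var m) (.var x)) (.seq p (.assign x (.add (.var x) (.const 1)))))

/-- Each round costs 4 for the test and 4 for the increment besides the body; the initial assignment
costs 2 and the last, failing test 4. The invariant is imposed after the counter has been set, so it
survives the increment by definition. -/
theorem Ensures.forRange {x m N : ℕ} (I : ℕ → State → Prop) (hxm : m ≠ x)
    (hx : p.Keeps x) (hm : p.Keeps m) (hN : s.var m = N) (h₀ : I 0 (s.setVar x 0))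
    (hstep : ∀ i < N, ∀ s', s'.var x = i → s'.var m = N → I i s' →
      Ensures ω p s' B (fun s'' => I (i + 1) (s''.setVar x (i + 1)))) :
    Ensures ω (Prog.forRange x m p) s (N * (B + 8) + 6) (I N) := by
  have key : ∀ r i s', i + r = N → s'.var x = i → s'.var m = N → I i s' →
      Ensures ω (.whileNonzero (.sub (.var m) (.var x))
        (.seq p (.assign x (.add (.var x) (.const 1))))) s' (r * (B + 8) + 4) (I N) := by
    intro r
    induction r with
    | zero =>
      intro i s' hi h1 h2 h3
      refine ⟨_, _, .while_false ?_, by simp [Expr.cost], ?_⟩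
      · simp [Expr.eval, h1, h2]; omega
      · rwa [← hi]
    | succ r ih =>
      intro i s' hi h1 h2 h3
      obtain ⟨t, s₁, hr, ht, h4⟩ := hstep i (by omega) s' h1 h2 h3
      have h5 : s₁.var x = i := by rw [hr.var_eq hx, h1]
      have h6 : s₁.var m = N := by rw [hr.var_eq hm, h2]
      obtain ⟨t', s₂, hr', ht', h7⟩ := ih (i + 1) (s₁.setVar x (i + 1)) (by omega) (by simp)
        (by simp [hxm, h6]) h4
      refine ⟨_, _, .while_true (t' := t') ?_ (.seq hr (.assign _ _ _)) ?_, ?_, h7⟩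
      · simp [Expr.eval, h1, h2]; omega
      · simpa [Expr.eval, h5] using hr'
      · simp only [Expr.cost]
        have : (r + 1) * (B + 8) = r * (B + 8) + (B + 8) := by ring
        omega
  obtain ⟨t, s', hr, ht, hI⟩ := key N 0 (s.setVar x 0) (by omega) (by simp) (by simp [hxm, hN]) h₀
  exact ⟨_, _, .seq (.assign _ _ _) hr, by simp only [Expr.cost]; omega, hI⟩

end RAM

/-! ### Push–relabel on a network with unit capacities -/

/-- The state of a push–relabel computation: residual capacities, excesses and heights. -/
@[ext] structure Preflow where
  cap : ℕ → ℕ → ℕ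
  ex : ℕ → ℕ
  ht : ℕ → ℕ

namespace Preflow

/-- Send one unit from `u` to `v` along a residual arc that leads downwards, if the excess of `u` is
above `k`. -/
def push (k u v : ℕ) (c : Preflow) : Preflow :=
  if k < c.ex u ∧ 0 < c.cap u v ∧ c.ht v < c.ht u then
    { cap := fun a b => if a = v ∧ b = u then c.cap v u + 1
        else if a = u ∧ b = v then c.cap u v - 1 else c.cap a b
      ex := fun a => if a = v then c.ex v + 1 else if a = u then c.ex u - 1 else c.ex a
      ht := c.ht }
  else c

/-- Raise `u` by one if its excess is above `k` and its height below `h`. -/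
def lift (k h u : ℕ) (c : Preflow) : Preflow :=
  if k < c.ex u ∧ c.ht u < h then
    { c with ht := fun a => if a = u then c.ht u + 1 else c.ht a }
  else c

/-- Try to push from `u` to each of the first `m` vertices. -/
def pushRow (k u : ℕ) (c : Preflow) : ℕ → Preflow
  | 0 => c
  | m + 1 => (pushRow k u c m).push k u m

/-- Discharge each of the first `m` of `N` vertices: push to all vertices, then lift. -/
def sweepTo (k N : ℕ) (c : Preflow) : ℕ → Preflow
  | 0 => c
  | m + 1 => (pushRow k m (sweepTo k N c m) N).lift k (N + 1) m

/-- Discharge each of the `N` vertices once. -/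
def sweep (k N : ℕ) (c : Preflow) : Preflow := sweepTo k N c N

/-- The network on the `n` rows `i` and the `n` columns `n + j` of a matrix for enlarging the zero-one
matrix `R ≤ A` to one below `A` with line sums `k`. -/
def initial (n k : ℕ) (A R : ℕ → ℕ → ℕ) : Preflow where
  cap a b := if a < n ∧ n ≤ b ∧ b < n + n then A a (b - n) - R a (b - n) else 0
  ex a := if a < n then k + k - ∑ j ∈ Finset.range n, R a j
    else if a < n + n then ∑ i ∈ Finset.range n, R i (a - n) else 0
  ht _ := 0

end Preflow

/-! ### Programs for the bit length and for products -/

namespace RAM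

variable {ω : ℕ → Bool} {s : State}

/-- Compute the bit length of variable `0` in variable `1`. -/
def sizeProg : Prog :=
  .seq (.assign 2 (.const 1)) <|
  .forRange 7 0 <|
    .ifNonzero (.sub (.add (.var 0) (.const 1)) (.var 2))
      (.seq (.assign 2 (.add (.var 2) (.var 2))) (.assign 1 (.add (.var 1) (.const 1)))) .skip

/-- The powers of two up to n are as many as the bit length of n. This is at most n, so n rounds
suffice and the later ones do nothing, whence the minimum in the invariant. -/
theorem sizeProg_spec {n : ℕ} (h0 : s.var 0 = n) (h1 : s.var 1 = 0) :
    Ensures ω sizeProg s (2 + (n * (15 + 8) + 6))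
      (fun s' => s'.var 1 = n.size ∧ s'.arr = s.arr ∧ s'.tossed = s.tossed) := by
  refine Ensures.seq (Ensures.assign ?_)
  refine (Ensures.forRange (N := n) (B := 15) (fun i s' => s'.var 0 = n ∧
    s'.var 2 = 2 ^ (min i n.size) ∧ s'.var 1 = min i n.size ∧ s'.arr = s.arr ∧
    s'.tossed = s.tossed) (by norm_num) ?_ ?_ ?_ ?_ ?_).mono le_rfl ?_
  · simp [Prog.Keeps]
  · simp [Prog.Keeps]
  · simp [h0]
  · simp [h0, h1, Expr.eval]
  · rintro i hi s' - - ⟨h2, h3, h4, h5, h6⟩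
    refine Ensures.mono (Ensures.ite (B := 8) (B' := 1) (fun he => ?_) (fun he => ?_)) ?_
      (fun _ h => h)
    · refine Ensures.seq (B := 4) (B' := 4) (Ensures.assign (Ensures.assign ?_))
      simp only [Expr.eval, h2, h3] at he
      have hs : i < n.size := by
        by_contra hc
        rw [min_eq_right (by omega)] at he
        have := Nat.lt_size_self n
        omega
      simp [Expr.eval, h2, h3, h4, h5, h6, min_eq_left hs.le, min_eq_left (Nat.succ_le_of_lt hs)]
      ring
    · refine Ensures.skip ?_
      simp only [Expr.eval, h2, h3] at he
      have hs : n.size ≤ i := by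
        by_contra hc
        rw [min_eq_left (by omega)] at he
        have := (Nat.lt_size (m := i) (n := n)).1 (by omega)
        omega
      simp [h2, h3, h4, h5, h6, min_eq_right hs, min_eq_right (hs.trans (Nat.le_succ i))]
    · simp [Expr.cost]
  · rintro s' ⟨-, -, h3, h4, h5⟩
    rw [min_eq_right] at h3
    · exact ⟨h3, h4, h5⟩
    · rw [Nat.size_le]; exact Nat.lt_two_pow_self

/-- Add the product of the variables `x` and `1` to the variable `y`. -/
def mulProg (x y : ℕ) : Prog := .forRange 7 1 (.assign y (.add (.var y) (.var x)))

theorem mulProg_spec {x y L a : ℕ} (hx : x ≠ 7) (hy : y ≠ 7) (hy1 : y ≠ 1) (hxy : x ≠ y)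
    (h1 : s.var 1 = L) (hx0 : s.var x = a) (hy0 : s.var y = 0) :
    Ensures ω (mulProg x y) s (L * (4 + 8) + 6)
      (fun s' => s'.var y = L * a ∧ s'.arr = s.arr ∧ s'.tossed = s.tossed) := by
  refine (Ensures.forRange (N := L) (B := 4) (fun i s' => s'.var x = a ∧
    s'.var y = i * a ∧ s'.arr = s.arr ∧ s'.tossed = s.tossed) (by norm_num) ?_ ?_ h1 ?_ ?_).mono
    le_rfl ?_
  · simpa [Prog.Keeps] using hy.symm
  · simpa [Prog.Keeps] using hy1.symm
  · simp [hx, hy, hx0, hy0]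
  · rintro i hi s' - - ⟨h2, h3, h4, h5⟩
    refine Ensures.assign ?_
    simp [hx, hy, hxy, h2, h3, h4, h5, Expr.eval]
    ring
  · rintro s' ⟨-, h2, h3, h4⟩
    exact ⟨h2, h3, h4⟩

end RAM

/-! ### Drawing one entry of the random submatrix -/

namespace RAM

variable {ω : ℕ → Bool} {s : State}

/-- Whether the `b` coins of the block number `m` all show heads. -/
def hit (ω : ℕ → Bool) (b m : ℕ) : ℕ := if ∀ c < b, ω (m * b + c) = true then 1 else 0

/-- The random submatrix of `A`, of format `n × n`, in which each entry is kept if its `b` coins all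
show heads. -/
def sample (ω : ℕ → Bool) (n b : ℕ) (A : ℕ → ℕ → ℕ) (i j : ℕ) : ℕ := A i j * hit ω b (i * n + j)

/-- Set variable `8` to the entry `(i, j)` of the input matrix, where `i` and `j` are the variables
`5` and `6`, and to zero if one of the coins tossed for that entry shows tails. -/
def coinProg : Prog :=
  .seq (.assign 2 (.var 3)) <|
  .seq (.assign 8 (.load 0 (.var 5) (.var 6))) <|
  .forRange 7 0 <|
    .ifNonzero (.sub (.add (.var 0) (.const 1)) (.var 2))
      (.seq (.assign 2 (.add (.var 2) (.var 2))) <|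
        .seq (.flip 9) (.ifNonzero (.var 9) .skip (.assign 8 (.const 0)))) .skip

/-- The bound q·2^i ≤ n holds exactly for i below the bit length of n / q, so doubling q finds the
number of coins without a division. Tossing continues after tails and on non-edges: every entry uses
up a block of the same length, which makes the entries functions of disjoint blocks. -/
theorem coinProg_spec {n q : ℕ} (hq : 0 < q) (h0 : s.var 0 = n) (h3 : s.var 3 = q) :
    Ensures ω coinProg s (2 + (4 + (n * (100 + 8) + 6))) (fun s' => s'.arr = s.arr ∧
      s'.tossed = s.tossed + (n / q).size ∧ s'.var 8 = s.arr 0 (s.var 5) (s.var 6) *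
        (if ∀ c < (n / q).size, ω (s.tossed + c) = true then 1 else 0)) := by
  set b := (n / q).size with hb
  have hbn : b ≤ n := by
    rw [hb, Nat.size_le]
    exact (Nat.div_le_self _ _).trans_lt Nat.lt_two_pow_self
  refine Ensures.seq (Ensures.assign (Ensures.seq (Ensures.assign ?_)))
  refine (Ensures.forRange (N := n) (B := 100) (fun i s' => s'.var 0 = n ∧
    s'.var 2 = q * 2 ^ (min i b) ∧ s'.arr = s.arr ∧
    s'.tossed = s.tossed + min i b ∧ s'.var 8 = s.arr 0 (s.var 5) (s.var 6) *
        (if ∀ c < min i b, ω (s.tossed + c) = true then 1 else 0)) (by norm_num) ?_ ?_ ?_ ?_ ?_).mono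
    le_rfl ?_
  · simp [Prog.Keeps]
  · simp [Prog.Keeps]
  · simp [h0]
  · simp [h0, h3, Expr.eval]
  · rintro i hi s' - - ⟨h2, h3, h4, h5, h6⟩
    refine Ensures.mono (Ensures.ite (B := 90) (B' := 1) (fun he => ?_) (fun he => ?_)) ?_
      (fun _ h => h)
    · simp only [Expr.eval, h2, h3] at he
      have hs : i < b := by
        by_contra hc
        rw [min_eq_right (by omega)] at he
        have := Nat.lt_size_self (n / q)
        rw [← hb, Nat.div_lt_iff_lt_mul hq, mul_comm] at this
        omega
      refine Ensures.seq (B := 4) (B' := 86) (Ensures.assign ?_)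
      refine Ensures.seq (B := 1) (B' := 85) (Ensures.flip ?_)
      refine Ensures.mono (Ensures.ite (B := 1) (B' := 2) (fun he' => ?_) (fun he' => ?_)) ?_
        (fun _ h => h)
      · refine Ensures.skip ?_
        have h7 : ω (s.tossed + i) = true := by
          by_contra hc
          simp [Expr.eval, h5, min_eq_left hs.le, hc] at he'
        refine ⟨by simpa using h2, ?_, by simpa using h4, ?_, ?_⟩
        · simp [Expr.eval, h3, min_eq_left hs.le, min_eq_left (Nat.succ_le_of_lt hs)]; ring
        · simp [h5, min_eq_left hs.le, min_eq_left (Nat.succ_le_of_lt hs)]; ring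
        · have h8 : (∀ c ≤ i, ω (s.tossed + c) = true) ↔ ∀ c < i, ω (s.tossed + c) = true :=
            ⟨fun h c hc => h c hc.le, fun h c hc => hc.lt_or_eq.elim (h c) (by rintro rfl; exact h7)⟩
          simp [h6, min_eq_left hs.le, min_eq_left (Nat.succ_le_of_lt hs), h8]
      · refine Ensures.assign ?_
        have h7 : ω (s.tossed + i) = false := by
          by_contra hc
          simp [Expr.eval, h5, min_eq_left hs.le, hc] at he'
        refine ⟨by simpa using h2, ?_, by simpa using h4, ?_, ?_⟩
        · simp [Expr.eval, h3, min_eq_left hs.le, min_eq_left (Nat.succ_le_of_lt hs)]; ring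
        · simp [h5, min_eq_left hs.le, min_eq_left (Nat.succ_le_of_lt hs)]; ring
        · simp only [Expr.eval, min_eq_left (Nat.succ_le_of_lt hs)]
          simp only [State.setVar_var, Nat.reduceEqDiff, ↓reduceIte]
          rw [if_neg, mul_zero]
          exact fun h => by simp [h i (Nat.lt_succ_self i)] at h7
      · simp [Expr.cost]
    · refine Ensures.skip ?_
      simp only [Expr.eval, h2, h3] at he
      have hs : b ≤ i := by
        by_contra hc
        rw [min_eq_left (by omega)] at he
        have := (Nat.lt_size (m := i) (n := n / q)).1 (by omega)
        rw [Nat.le_div_iff_mul_le hq, mul_comm] at this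
        omega
      rw [min_eq_right hs] at h3 h5 h6
      rw [min_eq_right (hs.trans (Nat.le_succ i))]
      simp [h2, h3, h4, h5, h6]
    · simp [Expr.cost]
  · rintro s' ⟨-, -, h3, h4, h5⟩
    rw [min_eq_right hbn] at h4 h5
    exact ⟨h3, h4, h5⟩

/-- Draw the entry `(i, j)` of the random submatrix and update the network. -/
def entryProg : Prog :=
  .seq coinProg <|
  .seq (.store 5 (.var 5) (.var 6) (.var 8)) <|
  .seq (.store 2 (.var 5) (.add (.var 0) (.var 6))
    (.sub (.load 0 (.var 5) (.var 6)) (.var 8))) <|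
  .seq (.store 3 (.const 0) (.var 5) (.sub (.load 3 (.const 0) (.var 5)) (.var 8))) <|
  .store 3 (.const 0) (.add (.var 0) (.var 6))
    (.add (.load 3 (.const 0) (.add (.var 0) (.var 6))) (.var 8))

theorem entryProg_spec {n q i j f : ℕ} (hq : 0 < q) (h0 : s.var 0 = n) (h3 : s.var 3 = q)
    (h5 : s.var 5 = i) (h6 : s.var 6 = j) (hi : i < n)
    (hf : f = s.arr 0 i j * (if ∀ c < (n / q).size, ω (s.tossed + c) = true then 1 else 0)) :
    Ensures ω entryProg s (n * (100 + 8) + 100) (fun s' =>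
      s'.tossed = s.tossed + (n / q).size ∧ s'.arr = fun a x y =>
        if a = 5 ∧ x = i ∧ y = j then f
        else if a = 2 ∧ x = i ∧ y = n + j then s.arr 0 i j - f
        else if a = 3 ∧ x = 0 ∧ y = i then s.arr 3 0 i - f
        else if a = 3 ∧ x = 0 ∧ y = n + j then s.arr 3 0 (n + j) + f
        else s.arr a x y) := by
  refine Ensures.mono (Ensures.seq (B' := 80) ((coinProg_spec hq h0 h3).and_keeps.mono le_rfl
    ?_)) (by omega) (fun _ h => h)
  rintro s₁ ⟨⟨h7, h8, h9⟩, hk⟩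
  have k0 : s₁.var 0 = n := by rw [hk 0 (by simp [coinProg, Prog.Keeps, Prog.forRange]), h0]
  have k5 : s₁.var 5 = i := by rw [hk 5 (by simp [coinProg, Prog.Keeps, Prog.forRange]), h5]
  have k6 : s₁.var 6 = j := by rw [hk 6 (by simp [coinProg, Prog.Keeps, Prog.forRange]), h6]
  rw [h5, h6, ← hf] at h9
  refine Ensures.seq (B := 4) (B' := 76) (Ensures.store ?_)
  refine Ensures.seq (B := 10) (B' := 66) (Ensures.store ?_)
  refine Ensures.seq (B := 8) (B' := 58) (Ensures.store ?_)
  refine Ensures.mono (Ensures.store ?_) (by simp [Expr.cost]) (fun _ h => h)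
  refine ⟨by simpa using h8, ?_⟩
  funext a x y
  simp only [Expr.eval, State.setArr_var, State.setArr_arr, k0, k5, k6, h9, h7]
  -- Row and column excesses lie in the same array; the two updates do not interfere because i < n.
  have : n + j ≠ i := by omega
  by_cases c1 : a = 5
  · subst c1; simp
  by_cases c2 : a = 2
  · subst c2; simp
  by_cases c3 : a = 3
  · subst c3
    by_cases c4 : x = 0
    · subst c4
      by_cases c5 : y = i
      · subst c5; simp [this.symm]
      · simp [c5, this]
    · simp [c4]
  · simp [c1, c2, c3]

end RAM

/-- The entries of a matrix that come before position `(i, j)` in the row by row order. -/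
def partMatrix (R : ℕ → ℕ → ℕ) (i j a c : ℕ) : ℕ := if a < i ∨ a = i ∧ c < j then R a c else 0

theorem partMatrix_succ (R : ℕ → ℕ → ℕ) (i j a c : ℕ) :
    partMatrix R i (j + 1) a c = partMatrix R i j a c + if c = j then (if a = i then R i j else 0)
      else 0 := by
  unfold partMatrix
  by_cases h1 : c = j
  · subst h1
    by_cases h2 : a = i
    · subst h2; simp
    · simp [h2]
  · have : c < j + 1 ↔ c < j := by omega
    simp [h1, this]

theorem partMatrix_end (R : ℕ → ℕ → ℕ) {n c : ℕ} (i a : ℕ) (hc : c < n) :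
    partMatrix R i n a c = partMatrix R (i + 1) 0 a c := by
  unfold partMatrix
  have : (a < i ∨ a = i ∧ c < n) ↔ (a < i + 1 ∨ a = i + 1 ∧ c < 0) := by omega
  simp only [this]

theorem Preflow.initial_congr {n k : ℕ} {A R A' R' : ℕ → ℕ → ℕ}
    (h : ∀ a < n, ∀ c < n, R a c = R' a c) (h' : ∀ a < n, ∀ c < n, A a c = A' a c) :
    initial n k A R = initial n k A' R' := by
  ext a b
  · simp only [initial]
    split_ifs with h1
    · rw [h _ h1.1 _ (by omega), h' _ h1.1 _ (by omega)]
    · rfl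
  · simp only [initial]
    split_ifs with h1 h2
    · congr 1
      exact Finset.sum_congr rfl fun c hc => h a h1 c (Finset.mem_range.1 hc)
    · exact Finset.sum_congr rfl fun c hc => h c (Finset.mem_range.1 hc) _ (by omega)
    · rfl
  · rfl

/-- Adding one entry to the partial matrix changes the network as follows. -/
theorem Preflow.initial_partMatrix_succ {n k i j : ℕ} (hi : i < n) (hj : j < n)
    (A R : ℕ → ℕ → ℕ) :
    initial n k (partMatrix A i (j + 1)) (partMatrix R i (j + 1)) =
      let c := initial n k (partMatrix A i j) (partMatrix R i j)
      { cap := fun x y => if x = i ∧ y = n + j then A i j - R i j else c.cap x y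
        ex := fun y => if y = i then c.ex i - R i j else
          if y = n + j then c.ex (n + j) + R i j else c.ex y
        ht := c.ht } := by
  ext a b
  · simp only [initial, partMatrix_succ]
    by_cases h1 : a = i ∧ b = n + j
    · obtain ⟨rfl, rfl⟩ := h1
      have h2 : n + j < n + n := by omega
      simp [hi, h2, partMatrix]
    · by_cases h2 : a < n ∧ n ≤ b ∧ b < n + n
      · have h3 : ¬ (b - n = j ∧ a = i) := by omega
        by_cases h4 : b - n = j
        · have h5 : a ≠ i := fun h => h3 ⟨h4, h⟩
          simp [h2, h5]
        · simp [h1, h2, h4]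
      · simp [h1, h2]
  · simp only [initial, partMatrix_succ]
    by_cases h1 : a = i
    · subst h1
      simp [hi, hj, Finset.sum_add_distrib, Nat.sub_sub]
    · by_cases h2 : a = n + j
      · subst h2
        simp [h1, hi, hj, Finset.sum_add_distrib]
      · by_cases h3 : a < n
        · simp [h1, h2, h3]
        · by_cases h4 : a < n + n
          · have : a - n ≠ j := by omega
            simp [h1, h2, h3, h4, this]
          · simp [h1, h2, h3, h4]
  · rfl

/-! ### Drawing the whole submatrix while maintaining the network -/

namespace RAM

variable {ω : ℕ → Bool} {s : State}

/-- The network that is stored in the arrays `2`, `3` and `4`. -/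
def State.preflow (s : State) : Preflow := ⟨s.arr 2, s.arr 3 0, s.arr 4 0⟩

/-- Initialize the excesses of the rows. -/
def initProg : Prog := .forRange 5 0 (.store 3 (.const 0) (.var 5) (.add (.var 4) (.var 4)))

theorem initProg_spec {n k : ℕ} (h0 : s.var 0 = n) (h4 : s.var 4 = k) :
    Ensures ω initProg s (n * (6 + 8) + 6) (fun s' => s'.tossed = s.tossed ∧
      s'.arr = fun a x y => if a = 3 ∧ x = 0 ∧ y < n then k + k else s.arr a x y) := by
  refine (Ensures.forRange (N := n) (B := 6) (fun i s' => s'.var 4 = k ∧ s'.tossed = s.tossed ∧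
      s'.arr = fun a x y => if a = 3 ∧ x = 0 ∧ y < i then k + k else s.arr a x y)
      (by norm_num) ?_ ?_ h0 ?_ ?_).mono le_rfl ?_
  · simp [Prog.Keeps]
  · simp [Prog.Keeps]
  · simp [h4]
  · rintro i hi s' h5 - ⟨h6, h7, h8⟩
    refine Ensures.store ?_
    refine ⟨by simpa using h6, by simpa using h7, ?_⟩
    funext a x y
    simp only [State.setVar_arr, State.setArr_arr, Expr.eval, h5, h6, h8]
    by_cases c1 : a = 3 ∧ x = 0
    · obtain ⟨rfl, rfl⟩ := c1
      by_cases c2 : y = i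
      · subst c2; simp
      · have : y < i + 1 ↔ y < i := by omega
        simp [c2, this]
    · have : ∀ P : Prop, ¬ (a = 3 ∧ x = 0 ∧ P) := fun P h => c1 ⟨h.1, h.2.1⟩
      simp [this]
  · rintro s' ⟨-, h1, h2⟩
    exact ⟨h1, h2⟩

/-- Draw the random submatrix. -/
def sampleProg : Prog := .forRange 5 0 (.forRange 6 0 entryProg)

theorem entryProg_keeps {x : ℕ} (h2 : x ≠ 2) (h7 : x ≠ 7) (h8 : x ≠ 8) (h9 : x ≠ 9) :
    entryProg.Keeps x := by
  simp [entryProg, coinProg, Prog.forRange, Prog.Keeps, h2, h7, h8, h9]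

/-- The situation when the entries before `(i, j)` have been drawn. -/
structure SampleInv (ω : ℕ → Bool) (n q k : ℕ) (A : ℕ → ℕ → ℕ) (i j : ℕ) (s : State) : Prop where
  var0 : s.var 0 = n
  var3 : s.var 3 = q
  arr0 : s.arr 0 = A
  tossed : s.tossed = (i * n + j) * (n / q).size
  arr5 : ∀ a < n, ∀ c < n,
    s.arr 5 a c = partMatrix (sample ω n (n / q).size A) i j a c
  preflow : s.preflow = Preflow.initial n k (partMatrix A i j)
    (partMatrix (sample ω n (n / q).size A) i j)

theorem SampleInv.entry {n q k i j : ℕ} {A : ℕ → ℕ → ℕ} (hq : 0 < q) (hi : i < n) (hj : j < n)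
    (h : SampleInv ω n q k A i j s) (h5 : s.var 5 = i) (h6 : s.var 6 = j) :
    Ensures ω entryProg s (n * (100 + 8) + 100) (SampleInv ω n q k A i (j + 1)) := by
  refine (entryProg_spec (f := sample ω n (n / q).size A i j) hq h.var0 h.var3 h5 h6 hi
    ?_).and_keeps.mono le_rfl ?_
  · simp [sample, hit, h.arr0, h.tossed]
  · rintro s' ⟨⟨h1, h2⟩, hk⟩
    refine ⟨?_, ?_, ?_, ?_, ?_, ?_⟩
    · rw [hk 0 (entryProg_keeps (by simp) (by simp) (by simp) (by simp)), h.var0]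
    · rw [hk 3 (entryProg_keeps (by simp) (by simp) (by simp) (by simp)), h.var3]
    · funext x y
      simp [h2, h.arr0]
    · rw [h1, h.tossed]; ring
    · intro a ha c hc
      simp only [h2, partMatrix_succ, h.arr5 a ha c hc]
      by_cases c1 : c = j
      · by_cases c2 : a = i
        · subst c1 c2; simp [partMatrix]
        · simp [c1, c2]
      · simp [c1]
    · rw [Preflow.initial_partMatrix_succ hi hj, ← h.preflow]
      simp only [State.preflow, h2, h.arr0]
      ext x y
      · simp
      · simp
      · simp

theorem SampleInv.setVar {n q k i j x v : ℕ} {A : ℕ → ℕ → ℕ} (h : SampleInv ω n q k A i j s)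
    (h0 : x ≠ 0) (h3 : x ≠ 3) : SampleInv ω n q k A i j (s.setVar x v) :=
  ⟨by simpa [h0.symm] using h.var0, by simpa [h3.symm] using h.var3, h.arr0, h.tossed, h.arr5,
    h.preflow⟩

theorem sampleProg_spec {n q k : ℕ} {A : ℕ → ℕ → ℕ} (hq : 0 < q)
    (h : SampleInv ω n q k A 0 0 s) :
    Ensures ω sampleProg s (n * ((n * ((n * (100 + 8) + 100) + 8) + 6) + 8) + 6)
      (SampleInv ω n q k A n 0) := by
  refine Ensures.forRange (N := n) (B := n * ((n * (100 + 8) + 100) + 8) + 6)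
    (fun i s' => SampleInv ω n q k A i 0 s') (by norm_num) ?_ ?_ h.var0
    (h.setVar (by norm_num) (by norm_num)) ?_
  · have := entryProg_keeps (x := 5) (by simp) (by simp) (by simp) (by simp)
    simp [Prog.forRange, Prog.Keeps, this]
  · have := entryProg_keeps (x := 0) (by simp) (by simp) (by simp) (by simp)
    simp [Prog.forRange, Prog.Keeps, this]
  · intro i hi s₁ h5 _ h₁
    refine (Ensures.forRange (N := n) (B := n * (100 + 8) + 100)
      (fun j s' => s'.var 5 = i ∧ SampleInv ω n q k A i j s') (by norm_num) ?_ ?_ h₁.var0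
      ⟨by simpa using h5, h₁.setVar (by norm_num) (by norm_num)⟩ ?_).mono le_rfl ?_
    · exact entryProg_keeps (by simp) (by simp) (by simp) (by simp)
    · exact entryProg_keeps (by simp) (by simp) (by simp) (by simp)
    · rintro j hj s₂ h6 - ⟨h5, h₂⟩
      refine (h₂.entry hq hi hj h5 h6).and_keeps.mono le_rfl ?_
      rintro s₃ ⟨h₃, hk⟩
      refine ⟨?_, h₃.setVar (by norm_num) (by norm_num)⟩
      have := hk 5 (entryProg_keeps (by simp) (by simp) (by simp) (by simp))
      simp [this, h5]
    · rintro s₂ ⟨-, h₂⟩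
      refine SampleInv.setVar ?_ (by norm_num) (by norm_num)
      refine ⟨h₂.var0, h₂.var3, h₂.arr0, by rw [h₂.tossed]; ring, ?_, ?_⟩
      · intro a ha c hc
        rw [h₂.arr5 a ha c hc, partMatrix_end _ _ _ hc]
      · rw [h₂.preflow]
        exact Preflow.initial_congr (fun a _ c hc => partMatrix_end _ _ _ hc)
          (fun a _ c hc => partMatrix_end _ _ _ hc)

end RAM

/-! ### Push–relabel, repetition and output as programs -/

namespace RAM

variable {ω : ℕ → Bool} {s : State}

/-- Push from vertex `u` to vertex `v`, the variables `11` and `12`, if possible. -/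
def pushProg : Prog :=
  .ifNonzero (.sub (.load 3 (.const 0) (.var 11)) (.var 4))
    (.ifNonzero (.load 2 (.var 11) (.var 12))
      (.ifNonzero (.sub (.load 4 (.const 0) (.var 11)) (.load 4 (.const 0) (.var 12)))
        (.seq (.store 2 (.var 11) (.var 12) (.sub (.load 2 (.var 11) (.var 12)) (.const 1))) <|
         .seq (.store 2 (.var 12) (.var 11) (.add (.load 2 (.var 12) (.var 11)) (.const 1))) <|
         .seq (.store 3 (.const 0) (.var 11) (.sub (.load 3 (.const 0) (.var 11)) (.const 1))) <|
         .store 3 (.const 0) (.var 12) (.add (.load 3 (.const 0) (.var 12)) (.const 1)))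
        .skip)
      .skip)
    .skip

/-- Lift vertex `u`, the variable `11`, if it is still active. -/
def liftProg : Prog :=
  .ifNonzero (.sub (.load 3 (.const 0) (.var 11)) (.var 4))
    (.ifNonzero (.sub (.add (.var 10) (.const 1)) (.load 4 (.const 0) (.var 11)))
      (.store 4 (.const 0) (.var 11) (.add (.load 4 (.const 0) (.var 11)) (.const 1)))
      .skip)
    .skip

/-- Discharge all vertices. -/
def sweepProg : Prog := .forRange 11 10 (.seq (.forRange 12 10 pushProg) liftProg)

/-- The situation when the network is `c`; the array `5` holds the matrix `R`. -/
structure NetInv (n k : ℕ) (R : ℕ → ℕ → ℕ) (c : Preflow) (s : State) : Prop where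
  var0 : s.var 0 = n
  var4 : s.var 4 = k
  var10 : s.var 10 = n + n
  arr5 : s.arr 5 = R
  preflow : s.preflow = c

theorem NetInv.setVar {n k x v : ℕ} {R : ℕ → ℕ → ℕ} {c : Preflow} (h : NetInv n k R c s)
    (h0 : x ≠ 0) (h4 : x ≠ 4) (h10 : x ≠ 10) : NetInv n k R c (s.setVar x v) :=
  ⟨by simpa [h0.symm] using h.var0, by simpa [h4.symm] using h.var4,
    by simpa [h10.symm] using h.var10, h.arr5, h.preflow⟩

theorem pushProg_spec {n k u v : ℕ} {R : ℕ → ℕ → ℕ} {c : Preflow} (h : NetInv n k R c s)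
    (hu : s.var 11 = u) (hv : s.var 12 = v) :
    Ensures ω pushProg s 100 (NetInv n k R (c.push k u v)) := by
  have e2 : s.arr 2 = c.cap := congrArg Preflow.cap h.preflow
  have e3 : s.arr 3 0 = c.ex := congrArg Preflow.ex h.preflow
  have e4 : s.arr 4 0 = c.ht := congrArg Preflow.ht h.preflow
  refine Ensures.mono (Ensures.ite (B := 75) (B' := 1) (fun h1 => ?_) (fun h1 => ?_))
    (by simp [Expr.cost]) (fun _ h => h)
  · refine Ensures.mono (Ensures.ite (B := 60) (B' := 1) (fun h2 => ?_) (fun h2 => ?_))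
      (by simp [Expr.cost]) (fun _ h => h)
    · refine Ensures.mono (Ensures.ite (B := 40) (B' := 1) (fun h3 => ?_) (fun h3 => ?_))
        (by simp [Expr.cost]) (fun _ h => h)
      · refine Ensures.seq (B := 8) (B' := 32) (Ensures.store ?_)
        refine Ensures.seq (B := 8) (B' := 24) (Ensures.store ?_)
        refine Ensures.seq (B := 8) (B' := 16) (Ensures.store ?_)
        refine Ensures.mono (Ensures.store ?_) (by simp [Expr.cost]) (fun _ h => h)
        simp only [Expr.eval, hu, hv, h.var4, e2, e3, e4] at h1 h2 h3
        have h4 : k < c.ex u ∧ 0 < c.cap u v ∧ c.ht v < c.ht u := by omega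
        have h5 : u ≠ v := by rintro rfl; omega
        refine ⟨h.var0, h.var4, h.var10, ?_, ?_⟩
        · rw [← h.arr5]; funext x y; simp
        · rw [Preflow.push, if_pos h4]
          ext x y
          · simp only [State.preflow, State.setArr_arr, State.setArr_var, Expr.eval, hu, hv, e2]
            by_cases c1 : x = v ∧ y = u
            · obtain ⟨rfl, rfl⟩ := c1
              simp [h5.symm]
            · simp [c1]
          · simp only [State.preflow, State.setArr_arr, State.setArr_var, Expr.eval, hu, hv, e3]
            simp [h5.symm]
          · simp [State.preflow, e4]
      · refine Ensures.skip ?_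
        simp only [Expr.eval, hu, hv, h.var4, e2, e3, e4] at h1 h2 h3
        rwa [Preflow.push, if_neg (by omega)]
    · refine Ensures.skip ?_
      simp only [Expr.eval, hu, hv, h.var4, e2, e3] at h1 h2
      rwa [Preflow.push, if_neg (by omega)]
  · refine Ensures.skip ?_
    simp only [Expr.eval, hu, h.var4, e3] at h1
    rwa [Preflow.push, if_neg (by omega)]

theorem liftProg_spec {n k u : ℕ} {R : ℕ → ℕ → ℕ} {c : Preflow} (h : NetInv n k R c s)
    (hu : s.var 11 = u) :
    Ensures ω liftProg s 50 (NetInv n k R (c.lift k (n + n + 1) u)) := by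
  have e3 : s.arr 3 0 = c.ex := congrArg Preflow.ex h.preflow
  have e4 : s.arr 4 0 = c.ht := congrArg Preflow.ht h.preflow
  refine Ensures.mono (Ensures.ite (B := 40) (B' := 1) (fun h1 => ?_) (fun h1 => ?_))
    (by simp [Expr.cost]) (fun _ h => h)
  · refine Ensures.mono (Ensures.ite (B := 20) (B' := 1) (fun h2 => ?_) (fun h2 => ?_))
      (by simp [Expr.cost]) (fun _ h => h)
    · refine Ensures.mono (Ensures.store ?_) (by simp [Expr.cost]) (fun _ h => h)
      simp only [Expr.eval, hu, h.var4, h.var10, e3, e4] at h1 h2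
      have h4 : k < c.ex u ∧ c.ht u < n + n + 1 := by omega
      refine ⟨h.var0, h.var4, h.var10, ?_, ?_⟩
      · rw [← h.arr5]; funext x y; simp
      · rw [Preflow.lift, if_pos h4, ← h.preflow]
        ext x y
        · simp [State.preflow]
        · simp [State.preflow]
        · simp [State.preflow, hu, Expr.eval]
    · refine Ensures.skip ?_
      simp only [Expr.eval, hu, h.var4, h.var10, e3, e4] at h1 h2
      rwa [Preflow.lift, if_neg (by omega)]
  · refine Ensures.skip ?_
    simp only [Expr.eval, hu, h.var4, e3] at h1
    rwa [Preflow.lift, if_neg (by omega)]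

theorem sweepProg_spec {n k : ℕ} {R : ℕ → ℕ → ℕ} {c : Preflow} (h : NetInv n k R c s) :
    Ensures ω sweepProg s ((n + n) * (((n + n) * (100 + 8) + 6 + 50) + 8) + 6)
      (NetInv n k R (c.sweep k (n + n))) := by
  refine Ensures.forRange (N := n + n) (B := (n + n) * (100 + 8) + 6 + 50)
    (fun u s' => NetInv n k R (c.sweepTo k (n + n) u) s') (by norm_num) ?_ ?_ h.var10
    (h.setVar (by norm_num) (by norm_num) (by norm_num)) ?_
  · simp [Prog.Keeps, Prog.forRange, pushProg, liftProg]
  · simp [Prog.Keeps, Prog.forRange, pushProg, liftProg]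
  · intro u hu s₁ h11 _ h₁
    refine Ensures.seq ((Ensures.forRange (N := n + n) (B := 100)
      (fun v s' => s'.var 11 = u ∧
        NetInv n k R ((c.sweepTo k (n + n) u).pushRow k u v) s') (by norm_num) ?_ ?_ h₁.var10
      ⟨by simpa using h11, h₁.setVar (by norm_num) (by norm_num) (by norm_num)⟩ ?_).mono le_rfl ?_)
    · simp [Prog.Keeps, pushProg]
    · simp [Prog.Keeps, pushProg]
    · rintro v hv s₂ h12 - ⟨h11, h₂⟩
      refine (pushProg_spec h₂ h11 h12).and_keeps.mono le_rfl ?_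
      rintro s₃ ⟨h₃, hk⟩
      refine ⟨?_, h₃.setVar (by norm_num) (by norm_num) (by norm_num)⟩
      have := hk 11 (by simp [Prog.Keeps, pushProg])
      simp [this, h11]
    · rintro s₂ ⟨h11, h₂⟩
      exact (liftProg_spec h₂ h11).mono le_rfl
        fun s₃ h₃ => h₃.setVar (by norm_num) (by norm_num) (by norm_num)

/-- Repeat a program `n ^ d` times, where `n` is the variable `0`. -/
def repeatProg (p : Prog) : ℕ → Prog
  | 0 => p
  | d + 1 => .forRange (20 + d) 0 (repeatProg p d)

/-- A bound for the cost of `repeatProg`. -/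
def repeatCost (n B : ℕ) : ℕ → ℕ
  | 0 => B
  | d + 1 => n * (repeatCost n B d + 8) + 6

theorem repeatProg_keeps {p : Prog} {x : ℕ} (hp : p.Keeps x) (d : ℕ) (hd : x < 20 ∨ 20 + d ≤ x) :
    (repeatProg p d).Keeps x := by
  induction d with
  | zero => exact hp
  | succ d ih =>
    have h1 : x ≠ 20 + d := by omega
    have := ih (by omega)
    simp [repeatProg, Prog.forRange, Prog.Keeps, h1, this]

/-- Nested loops repeat n ^ d times without computing that power; their counters start at 20, out of
reach of the repeated program. -/
theorem repeatProg_spec {n k : ℕ} {R : ℕ → ℕ → ℕ} {p : Prog} {f : Preflow → Preflow} {B : ℕ}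
    (hp0 : p.Keeps 0) (hp : ∀ x, 20 ≤ x → p.Keeps x)
    (h : ∀ c s, NetInv n k R c s → Ensures ω p s B (NetInv n k R (f c))) (d : ℕ) :
    ∀ c s, NetInv n k R c s →
      Ensures ω (repeatProg p d) s (repeatCost n B d) (NetInv n k R (f^[n ^ d] c)) := by
  induction d with
  | zero => simpa [repeatProg, repeatCost] using h
  | succ d ih =>
    intro c s hs
    have hn : ∀ v s', NetInv n k R v s' → ∀ w, NetInv n k R v (s'.setVar (20 + d) w) :=
      fun v s' hs' w => hs'.setVar (by omega) (by omega) (by omega)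
    refine (Ensures.forRange (N := n) (fun i s' => NetInv n k R (f^[n ^ d * i] c) s')
      (by omega) ?_ ?_ hs.var0 (hn _ _ (by simpa using hs) _) ?_).mono le_rfl ?_
    · exact repeatProg_keeps (hp _ (by omega)) _ (by omega)
    · exact repeatProg_keeps hp0 _ (by omega)
    · intro i _ s' _ _ hs'
      refine (ih _ _ hs').mono le_rfl fun s'' hs'' => hn _ _ ?_ _
      rwa [← Function.iterate_add_apply, add_comm, ← Nat.mul_succ] at hs''
    · intro s' hs'
      rwa [pow_succ]

/-- Write the result into array `1`. -/
def outputProg : Prog :=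
  .forRange 5 0 <| .forRange 6 0 <| .store 1 (.var 5) (.var 6)
    (.add (.add (.load 5 (.var 5) (.var 6)) (.load 2 (.add (.var 0) (.var 6)) (.var 5)))
      (.add (.load 5 (.var 6) (.var 5)) (.load 2 (.add (.var 0) (.var 5)) (.var 6))))

/-- In the application the arc from column n + j to row i starts with capacity 0, so its residual
capacity is the flow sent from i to n + j. The written matrix is then R plus the flow, added to its
own transpose. -/
theorem outputProg_spec {n k : ℕ} {R : ℕ → ℕ → ℕ} {c : Preflow} (h : NetInv n k R c s) :
    Ensures ω outputProg s (n * ((n * (50 + 8) + 6) + 8) + 6) (fun s' => ∀ i < n, ∀ j < n,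
      s'.arr 1 i j = (R i j + c.cap (n + j) i) + (R j i + c.cap (n + i) j)) := by
  refine (Ensures.forRange (N := n) (B := n * (50 + 8) + 6) (fun i s' => NetInv n k R c s' ∧
    ∀ a < i, ∀ j < n, s'.arr 1 a j = (R a j + c.cap (n + j) a) + (R j a + c.cap (n + a) j))
    (by norm_num) ?_ ?_ h.var0 ?_ ?_).mono le_rfl fun _ h => h.2
  · simp [Prog.Keeps, Prog.forRange]
  · simp [Prog.Keeps, Prog.forRange]
  · exact ⟨h.setVar (by norm_num) (by norm_num) (by norm_num), by simp⟩
  · rintro i hi s₁ h5 - ⟨h₁, h₂⟩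
    refine (Ensures.forRange (N := n) (B := 50) (fun j s' => s'.var 5 = i ∧ NetInv n k R c s' ∧
      (∀ a < i, ∀ j < n, s'.arr 1 a j = (R a j + c.cap (n + j) a) + (R j a + c.cap (n + a) j)) ∧
      ∀ b < j, s'.arr 1 i b = (R i b + c.cap (n + b) i) + (R b i + c.cap (n + i) b))
      (by norm_num) ?_ ?_ h₁.var0 ?_ ?_).mono le_rfl ?_
    · simp [Prog.Keeps]
    · simp [Prog.Keeps]
    · exact ⟨by simpa using h5, h₁.setVar (by norm_num) (by norm_num) (by norm_num),
        by simpa using h₂, by simp⟩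
    · rintro j hj s₂ h6 - ⟨h5, h₃, h₄, h₅⟩
      refine Ensures.mono (Ensures.store ?_) (by simp [Expr.cost]) (fun _ h => h)
      have e2 : s₂.arr 2 = c.cap := congrArg Preflow.cap h₃.preflow
      refine ⟨by simpa using h5, NetInv.setVar ?_ (by norm_num) (by norm_num) (by norm_num),
        ?_, ?_⟩
      · refine ⟨h₃.var0, h₃.var4, h₃.var10, ?_, ?_⟩
        · rw [← h₃.arr5]; funext x y; simp
        · rw [← h₃.preflow]
          ext x y <;> simp [State.preflow]
      · intro a ha b hb
        have : a ≠ i := ha.ne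
        simpa [Expr.eval, h5, this] using h₄ a ha b hb
      · intro b hb
        by_cases c1 : b = j
        · subst c1
          simp [Expr.eval, h5, h6, h₃.var0, e2, h₃.arr5]
        · simpa [Expr.eval, h5, h6, c1] using h₅ b (by omega)
    · rintro s₂ ⟨-, h₃, h₄, h₅⟩
      refine ⟨h₃.setVar (by norm_num) (by norm_num) (by norm_num), ?_⟩
      intro a ha j hj
      rcases Nat.lt_succ_iff_lt_or_eq.1 ha with ha | rfl
      · simpa using h₄ a ha j hj
      · simpa using h₅ j hj

end RAM

/-! ### The complete program -/

namespace RAM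

variable {ω : ℕ → Bool}

/-- Sample a submatrix of the adjacency matrix and make its line sums equal. -/
def mainProg : Prog :=
  .seq sizeProg <| .seq (mulProg 1 3) <| .seq (mulProg 3 4) <|
  .seq (.assign 10 (.add (.var 0) (.var 0))) <| .seq initProg <| .seq sampleProg <|
  .seq (repeatProg sweepProg 5) outputProg

open Polynomial in
/-- A bound for the number of steps of `mainProg`. -/
noncomputable def mainCost : ℕ[X] :=
  (2 + (X * (15 + 8) + 6)) + ((X * (4 + 8) + 6) + ((X * (4 + 8) + 6) + (4 +
  ((X * (6 + 8) + 6) + ((X * ((X * ((X * (100 + 8) + 100) + 8) + 6) + 8) + 6) +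
  ((X * ((X * ((X * ((X * ((X * (((X + X) * (((X + X) * (100 + 8) + 6 + 50) + 8) + 6) + 8) + 6) + 8)
    + 6) + 8) + 6) + 8) + 6) + 8) + 6) + (X * ((X * (50 + 8) + 6) + 8) + 6)))))))

/-- The adjacency matrix of a graph. -/
noncomputable def adjMat {n : ℕ} (G : SimpleGraph (Fin n)) : ℕ → ℕ → ℕ := (State.input G).arr 0

/-- The network after the computation. -/
noncomputable def finalNet {n : ℕ} (G : SimpleGraph (Fin n)) (k : ℕ) (R : ℕ → ℕ → ℕ) : Preflow :=
  (Preflow.sweep k (n + n))^[n ^ 5] (Preflow.initial n k (adjMat G) R)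

theorem mainProg_spec {n L q k : ℕ} (hn : 0 < n) (G : SimpleGraph (Fin n)) {R : ℕ → ℕ → ℕ}
    (hL : L = n.size) (hq : q = L * L) (hk : k = L * q)
    (hR : R = sample ω n (n / q).size (adjMat G)) :
    Ensures ω mainProg (State.input G) (mainCost.eval n) (fun s' => ∀ i < n, ∀ j < n,
      s'.arr 1 i j = (R i j + (finalNet G k R).cap (n + j) i) +
        (R j i + (finalNet G k R).cap (n + i) j)) := by
  have hL0 : 0 < L := by rw [hL]; exact Nat.size_pos.2 hn
  have hq0 : 0 < q := by rw [hq]; positivity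
  have hLn : L ≤ n := by rw [hL, Nat.size_le]; exact Nat.lt_two_pow_self
  -- The multiplications take L rounds; the cost polynomial charges n rounds for them.
  have hcost := Nat.mul_le_mul_right (4 + 8) hLn
  simp only [mainCost, Polynomial.eval_add, Polynomial.eval_mul, Polynomial.eval_X,
    Polynomial.eval_ofNat]
  refine Ensures.seq ((sizeProg_spec (n := n) (by simp [State.input]) (by simp [State.input]
    )).and_keeps.mono le_rfl ?_)
  rintro s₁ ⟨⟨v1, a1, t1⟩, k1⟩
  rw [← hL] at v1
  refine Ensures.seq ((mulProg_spec (by norm_num) (by norm_num) (by norm_num) (by norm_num)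
    v1 v1 ?_).and_keeps.mono (by omega) ?_)
  · rw [k1 3 (by simp [sizeProg, Prog.forRange, Prog.Keeps])]; simp [State.input]
  rintro s₂ ⟨⟨v2, a2, t2⟩, k2⟩
  rw [← hq] at v2
  have w1 : s₂.var 1 = L := by rw [k2 1 (by simp [mulProg, Prog.forRange, Prog.Keeps]), v1]
  refine Ensures.seq ((mulProg_spec (by norm_num) (by norm_num) (by norm_num) (by norm_num)
    w1 v2 ?_).and_keeps.mono (by omega) ?_)
  · rw [k2 4 (by simp [mulProg, Prog.forRange, Prog.Keeps]),
      k1 4 (by simp [sizeProg, Prog.forRange, Prog.Keeps])]; simp [State.input]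
  rintro s₃ ⟨⟨v3, a3, t3⟩, k3⟩
  rw [← hk] at v3
  have w0 : s₃.var 0 = n := by
    rw [k3 0 (by simp [mulProg, Prog.forRange, Prog.Keeps]),
      k2 0 (by simp [mulProg, Prog.forRange, Prog.Keeps]),
      k1 0 (by simp [sizeProg, Prog.forRange, Prog.Keeps])]; simp [State.input]
  have w3 : s₃.var 3 = q := by rw [k3 3 (by simp [mulProg, Prog.forRange, Prog.Keeps]), v2]
  refine Ensures.seq (Ensures.assign ?_)
  rw [a2, a1] at a3
  rw [t2, t1] at t3
  simp only [Expr.eval, w0]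
  refine Ensures.seq ((initProg_spec (n := n) (k := k) (by simp [w0])
    (by simp [v3])).and_keeps.mono le_rfl ?_)
  rintro s₄ ⟨⟨t4, a4⟩, k4⟩
  have u0 : s₄.var 0 = n := by
    rw [k4 0 (by simp [initProg, Prog.forRange, Prog.Keeps])]; simp [w0]
  have u3 : s₄.var 3 = q := by
    rw [k4 3 (by simp [initProg, Prog.forRange, Prog.Keeps])]; simp [w3]
  have u4 : s₄.var 4 = k := by
    rw [k4 4 (by simp [initProg, Prog.forRange, Prog.Keeps])]; simp [v3]
  have u10 : s₄.var 10 = n + n := by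
    rw [k4 10 (by simp [initProg, Prog.forRange, Prog.Keeps])]; simp
  simp only [State.setVar_arr, State.setVar_tossed, a3, t3] at a4 t4
  -- Zeroed arrays with excess 2k on the rows are the network of the empty partial matrix, the
  -- starting point of the sampling invariant.
  have hzero : ∀ a, a ≠ 0 → ∀ x y, (State.input G).arr a x y = 0 := by
    intro a ha x y; simp [State.input, ha]
  refine Ensures.seq ((sampleProg_spec (n := n) (q := q) (k := k) (A := adjMat G) hq0
    ⟨u0, u3, ?_, ?_, ?_, ?_⟩).and_keeps.mono le_rfl ?_)
  · funext x y; simp [a4, adjMat]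
  · rw [t4]; simp [State.input]
  · intro a _ c _; simp [a4, hzero, partMatrix]
  · ext x y
    · simp [State.preflow, a4, hzero, Preflow.initial, partMatrix]
    · simp [State.preflow, a4, hzero, Preflow.initial, partMatrix]
    · simp [State.preflow, a4, hzero, Preflow.initial]
  rintro s₅ ⟨h5, k5⟩
  subst hR
  have hkeep : ∀ x, x ≠ 2 → x ≠ 7 → x ≠ 8 → x ≠ 9 → x ≠ 5 → x ≠ 6 → sampleProg.Keeps x := by
    intro x x2 x7 x8 x9 x5 x6
    simp [sampleProg, Prog.forRange, Prog.Keeps, x5, x6, entryProg_keeps x2 x7 x8 x9]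
  have hpart : ∀ (M : ℕ → ℕ → ℕ), ∀ a < n, ∀ c < n, partMatrix M n 0 a c = M a c := by
    intro M a ha c _; simp [partMatrix, ha]
  have hnet : NetInv n k (s₅.arr 5)
      (Preflow.initial n k (adjMat G) (sample ω n (n / q).size (adjMat G))) s₅ := by
    refine ⟨h5.var0, ?_, ?_, rfl, ?_⟩
    · rw [k5 4 (hkeep 4 (by simp) (by simp) (by simp) (by simp) (by simp) (by simp)), u4]
    · rw [k5 10 (hkeep 10 (by simp) (by simp) (by simp) (by simp) (by simp) (by simp)), u10]
    · rw [h5.preflow]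
      exact Preflow.initial_congr (hpart _) (hpart _)
  refine Ensures.seq ((repeatProg_spec (p := sweepProg) ?_ ?_
    (fun c s hs => sweepProg_spec hs) 5 _ _ hnet).mono (by simp [repeatCost]) ?_)
  · simp [sweepProg, pushProg, liftProg, Prog.forRange, Prog.Keeps]
  · intro x hx
    simp [sweepProg, pushProg, liftProg, Prog.forRange, Prog.Keeps]
    omega
  intro s₆ h6
  refine (outputProg_spec h6).mono le_rfl ?_
  intro s₇ h7 i hi j hj
  rw [h7 i hi j hj, h5.arr5 i hi j hj, h5.arr5 j hj i hi, hpart _ i hi j hj, hpart _ j hj i hi]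
  rfl

end RAM

/-! ### Correctness and termination of push–relabel -/

theorem Finset.sum_range_add_of_eq_off {N v : ℕ} {f g : ℕ → ℕ} (hv : v < N)
    (h : ∀ w, w ≠ v → g w = f w) :
    ∑ w ∈ Finset.range N, g w + f v = ∑ w ∈ Finset.range N, f w + g v := by
  have hv' := Finset.mem_range.2 hv
  rw [← Finset.add_sum_erase _ f hv', ← Finset.add_sum_erase _ g hv',
    Finset.sum_congr rfl fun w hw => h w (Finset.ne_of_mem_erase hw)]
  ring

theorem Finset.sum_range_add_of_eq_off_pair {N u v : ℕ} {f g : ℕ → ℕ} (hu : u < N) (hv : v < N)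
    (huv : u ≠ v) (h : ∀ w, w ≠ u → w ≠ v → g w = f w) :
    ∑ w ∈ Finset.range N, g w + (f u + f v) = ∑ w ∈ Finset.range N, f w + (g u + g v) := by
  have h1 := Finset.sum_range_add_of_eq_off (f := f) (g := Function.update f u (g u)) hu
    (fun w hw => by simp [hw])
  have h2 := Finset.sum_range_add_of_eq_off (f := Function.update f u (g u)) (g := g) hv
    (fun w hw => by
      by_cases hwu : w = u
      · subst hwu; simp
      · simp [hwu, h w hwu hw])
  simp only [Function.update_self, Function.update_of_ne huv.symm] at h1 h2
  omega

namespace Preflow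

/-- The invariants of push–relabel, started in `c₀`. -/
structure Valid (k N E : ℕ) (c₀ c : Preflow) : Prop where
  height : ∀ u < N, ∀ v < N, 0 < c.cap u v → c.ht u ≤ c.ht v + 1
  bound : ∀ u < N, c.ht u ≤ N + 1
  nonneg : ∀ u < N, 0 < c.ht u → k ≤ c.ex u
  total : ∑ u ∈ Finset.range N, (c.ex u - k) ≤ E
  pair : ∀ u < N, ∀ v < N, c.cap u v + c.cap v u = c₀.cap u v + c₀.cap v u
  cons : ∀ u < N, c.ex u + ∑ v ∈ Finset.range N, c₀.cap u v =
    c₀.ex u + ∑ v ∈ Finset.range N, c.cap u v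

/-- The potential that drops with each push and each lift. -/
def potential (k N E : ℕ) (c : Preflow) : ℕ :=
  (E + 1) * ∑ u ∈ Finset.range N, (N + 1 - c.ht u) + ∑ u ∈ Finset.range N, (c.ex u - k) * c.ht u

variable {k N E : ℕ} {c₀ c : Preflow}

/-- The new reverse arc leads upwards, so it cannot break the height condition. The unit leaves an
active vertex, so the total active excess does not grow, and it moves to a smaller height, so the
potential drops. -/
theorem Valid.push (hc : Valid k N E c₀ c) {u v : ℕ} (hu : u < N) (hv : v < N) :
    Valid k N E c₀ (c.push k u v) ∧
      (c.push k u v = c ∨ (c.push k u v).potential k N E < c.potential k N E) := by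
  by_cases h : k < c.ex u ∧ 0 < c.cap u v ∧ c.ht v < c.ht u
  swap
  · rw [Preflow.push, if_neg h]
    exact ⟨hc, Or.inl rfl⟩
  rw [Preflow.push, if_pos h]
  obtain ⟨h1, h2, h3⟩ := h
  have huv : u ≠ v := by rintro rfl; omega
  refine ⟨⟨?_, hc.bound, ?_, ?_, ?_, ?_⟩, Or.inr ?_⟩
  · intro a ha b hb hab
    simp only at hab ⊢
    by_cases e1 : a = v ∧ b = u
    · obtain ⟨rfl, rfl⟩ := e1; omega
    · rw [if_neg e1] at hab
      by_cases e2 : a = u ∧ b = v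
      · obtain ⟨rfl, rfl⟩ := e2
        exact hc.height a ha b hb h2
      · rw [if_neg e2] at hab
        exact hc.height a ha b hb hab
  · intro a ha hta
    have := hc.nonneg a ha hta
    simp only
    split_ifs with e1 e2
    · subst e1; omega
    · subst e2; omega
    · exact this
  · have := Finset.sum_range_add_of_eq_off_pair (f := fun w => c.ex w - k)
      (g := fun a => (if a = v then c.ex v + 1 else if a = u then c.ex u - 1 else c.ex a) - k)
      hu hv huv (fun w w1 w2 => by simp [w1, w2])
    simp only [huv, if_true, if_false] at this
    have := hc.total
    simp only
    omega
  · intro a ha b hb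
    have := hc.pair a ha b hb
    by_cases e1 : a = v ∧ b = u
    · obtain ⟨rfl, rfl⟩ := e1
      simp only [and_self, if_true, huv, false_and, if_false]
      omega
    · by_cases e2 : a = u ∧ b = v
      · obtain ⟨rfl, rfl⟩ := e2
        simp only [and_self, if_true, huv, false_and, if_false]
        omega
      · have e3 : ¬ (b = v ∧ a = u) := fun h => e2 ⟨h.2, h.1⟩
        have e4 : ¬ (b = u ∧ a = v) := fun h => e1 ⟨h.2, h.1⟩
        simp only [e1, e2, e3, e4, if_false]
        exact this
  · intro a ha
    have h5 := hc.cons a ha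
    by_cases e1 : a = v
    · subst e1
      have := Finset.sum_range_add_of_eq_off (f := c.cap a)
        (g := fun b => if a = a ∧ b = u then c.cap a u + 1
          else if a = u ∧ b = a then c.cap u a - 1 else c.cap a b) hu
        (fun w hw => by simp [hw, huv.symm])
      simp only [true_and, if_true] at this ⊢
      omega
    · by_cases e2 : a = u
      · subst e2
        have := Finset.sum_range_add_of_eq_off (f := c.cap a)
          (g := fun b => if a = v ∧ b = a then c.cap v a + 1
            else if a = a ∧ b = v then c.cap a v - 1 else c.cap a b) hv
          (fun w hw => by simp [hw, huv])
        simp only [true_and, if_true, huv, false_and, if_false] at this ⊢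
        omega
      · simpa [e1, e2] using h5
  · have := Finset.sum_range_add_of_eq_off_pair (f := fun w => (c.ex w - k) * c.ht w)
      (g := fun a => ((if a = v then c.ex v + 1 else if a = u then c.ex u - 1 else c.ex a) - k) *
        c.ht a) hu hv huv (fun w w1 w2 => by simp [w1, w2])
    simp only [huv, if_true, if_false] at this
    have h6 : (c.ex u - k) * c.ht u = (c.ex u - 1 - k) * c.ht u + c.ht u := by
      obtain ⟨d, hd⟩ : ∃ d, c.ex u = k + 1 + d := ⟨c.ex u - k - 1, by omega⟩
      rw [show c.ex u - k = d + 1 by omega, show c.ex u - 1 - k = d by omega]; ring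
    -- This is only an inequality: a unit that arrives at a vertex with excess below `k` creates no
    -- active excess.
    have h7 : (c.ex v + 1 - k) * c.ht v ≤ (c.ex v - k) * c.ht v + c.ht v := by
      calc _ ≤ (c.ex v - k + 1) * c.ht v := Nat.mul_le_mul_right _ (by omega)
        _ = _ := by ring
    simp only [potential]
    omega

/-- Once no residual arc leads downwards from an active u, raising u by one keeps the height
condition. The first part of the potential drops by E + 1, which outweighs the growth of the second
part by the active excess of u, at most E. -/
theorem Valid.lift (hc : Valid k N E c₀ c) {u : ℕ} (hu : u < N)
    (hlow : k < c.ex u → ∀ v < N, 0 < c.cap u v → c.ht u ≤ c.ht v) :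
    Valid k N E c₀ (c.lift k (N + 1) u) ∧
      ((c.lift k (N + 1) u = c ∧ ¬ (k < c.ex u ∧ c.ht u < N + 1)) ∨
        (c.lift k (N + 1) u).potential k N E < c.potential k N E) := by
  by_cases h : k < c.ex u ∧ c.ht u < N + 1
  swap
  · rw [Preflow.lift, if_neg h]
    exact ⟨hc, Or.inl ⟨rfl, h⟩⟩
  rw [Preflow.lift, if_pos h]
  obtain ⟨h1, h2⟩ := h
  refine ⟨⟨?_, ?_, ?_, hc.total, hc.pair, hc.cons⟩, Or.inr ?_⟩
  · intro a ha b hb hab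
    have h3 := hc.height a ha b hb hab
    have h4 := hlow h1 b hb
    simp only at hab ⊢
    split_ifs with e1 e2 e2
    · omega
    · subst e1; exact Nat.succ_le_succ (h4 hab)
    · subst e2; omega
    · exact h3
  · intro a ha
    have := hc.bound a ha
    simp only
    split_ifs with e1 <;> omega
  · intro a ha
    have := hc.nonneg a ha
    simp only
    split_ifs with e1
    · subst e1; omega
    · exact this
  · have h3 := Finset.sum_range_add_of_eq_off (f := fun w => N + 1 - c.ht w)
      (g := fun w => N + 1 - (if w = u then c.ht u + 1 else c.ht w)) hu
      (fun w hw => by simp [hw])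
    have h4 := Finset.sum_range_add_of_eq_off (f := fun w => (c.ex w - k) * c.ht w)
      (g := fun w => (c.ex w - k) * (if w = u then c.ht u + 1 else c.ht w)) hu
      (fun w hw => by simp [hw])
    simp only [if_true] at h3 h4
    have h5 : c.ex u - k ≤ E := le_trans
      (Finset.single_le_sum (f := fun w => c.ex w - k) (fun _ _ => Nat.zero_le _)
        (Finset.mem_range.2 hu)) hc.total
    have h6 : ∑ w ∈ Finset.range N, (N + 1 - c.ht w) =
      ∑ w ∈ Finset.range N, (N + 1 - (if w = u then c.ht u + 1 else c.ht w)) + 1 := by omega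
    simp only [potential, h6]
    rw [mul_add] at h4 ⊢
    omega

/-- With unit capacities one push saturates an arc. Pushes out of u open no arc leaving u and change
no height, so a single pass leaves u either inactive or without downward arcs among those tried, as
needed for the lift. -/
theorem Valid.pushRow (hc : Valid k N E c₀ c)
    (h₀ : ∀ u < N, ∀ v < N, c₀.cap u v + c₀.cap v u ≤ 1) {u : ℕ} (hu : u < N) {m : ℕ}
    (hm : m ≤ N) :
    Valid k N E c₀ (c.pushRow k u m) ∧
      (c.pushRow k u m = c ∨ (c.pushRow k u m).potential k N E < c.potential k N E) ∧
      (k < (c.pushRow k u m).ex u → ∀ v < m, 0 < (c.pushRow k u m).cap u v →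
        (c.pushRow k u m).ht u ≤ (c.pushRow k u m).ht v) := by
  induction m with
  | zero => exact ⟨hc, Or.inl rfl, fun _ v hv => by omega⟩
  | succ m ih =>
    obtain ⟨i1, i2, i3⟩ := ih (by omega)
    simp only [Preflow.pushRow]
    set d := c.pushRow k u m with hd
    obtain ⟨j1, j2⟩ := i1.push (k := k) hu (v := m) (by omega)
    refine ⟨j1, ?_, ?_⟩
    · rcases j2 with j2 | j2
      · rwa [j2]
      · rcases i2 with i2 | i2
        · right; rwa [i2] at j2 ⊢
        · right; omega
    · by_cases h : k < d.ex u ∧ 0 < d.cap u m ∧ d.ht m < d.ht u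
      · have hum : u ≠ m := by rintro rfl; omega
        have h1 : d.cap u m ≤ 1 := by
          have := i1.pair u hu m (by omega)
          have := h₀ u hu m (by omega)
          omega
        rw [Preflow.push, if_pos h]
        intro _ v hv
        simp only [hum, false_and, if_false, true_and]
        intro h3
        by_cases hvm : v = m
        · rw [if_pos hvm] at h3; omega
        · rw [if_neg hvm] at h3
          exact i3 h.1 v (by omega) h3
      · rw [Preflow.push, if_neg h]
        intro h1 v hv h2
        by_cases hvm : v = m
        · subst hvm; omega
        · exact i3 h1 v (by omega) h2

/-- No vertex below the top height is active. -/
def Done (k N : ℕ) (c : Preflow) : Prop := ∀ u < N, ¬ (k < c.ex u ∧ c.ht u < N + 1)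

/-- A sweep with any push or lift lowers the potential. A sweep with neither has met every vertex in
the unchanged network and found none that could be lifted. -/
theorem Valid.sweep (hc : Valid k N E c₀ c)
    (h₀ : ∀ u < N, ∀ v < N, c₀.cap u v + c₀.cap v u ≤ 1) :
    Valid k N E c₀ (c.sweep k N) ∧
      ((c.sweep k N = c ∧ c.Done k N) ∨
        (c.sweep k N).potential k N E < c.potential k N E) := by
  have key : ∀ m ≤ N, Valid k N E c₀ (c.sweepTo k N m) ∧
      ((c.sweepTo k N m = c ∧ ∀ u < m, ¬ (k < c.ex u ∧ c.ht u < N + 1)) ∨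
        (c.sweepTo k N m).potential k N E < c.potential k N E) := by
    intro m
    induction m with
    | zero => exact fun _ => ⟨hc, Or.inl ⟨rfl, fun u hu => by omega⟩⟩
    | succ m ih =>
      intro hm
      obtain ⟨i1, i2⟩ := ih (by omega)
      obtain ⟨j1, j2, j3⟩ := i1.pushRow h₀ (u := m) (by omega) le_rfl
      obtain ⟨l1, l2⟩ := j1.lift (u := m) (by omega) j3
      refine ⟨l1, ?_⟩
      simp only [Preflow.sweepTo]
      rcases l2 with ⟨l2, l3⟩ | l2
      · rw [l2]
        rcases j2 with j2 | j2
        · rw [j2] at l3 ⊢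
          rcases i2 with ⟨i2, i3⟩ | i2
          · rw [i2] at l3 ⊢
            left
            refine ⟨rfl, fun u hu => ?_⟩
            rcases Nat.lt_succ_iff_lt_or_eq.1 hu with hu | rfl
            · exact i3 u hu
            · exact l3
          · exact Or.inr i2
        · rcases i2 with ⟨i2, -⟩ | i2
          · right; rwa [i2] at j2 ⊢
          · right; omega
      · have j4 : ((c.sweepTo k N m).pushRow k m N).potential k N E ≤
            (c.sweepTo k N m).potential k N E := by
          rcases j2 with j2 | j2
          · rw [j2]
          · exact j2.le
        have i4 : (c.sweepTo k N m).potential k N E ≤ c.potential k N E := by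
          rcases i2 with ⟨i2, -⟩ | i2
          · rw [i2]
          · exact i2.le
        right; omega
  exact key N le_rfl

/-- A finished network is a fixed point of the sweep, so superfluous sweeps are harmless and a fixed
number above the initial potential will do. -/
theorem Valid.iterate (hc : Valid k N E c₀ c)
    (h₀ : ∀ u < N, ∀ v < N, c₀.cap u v + c₀.cap v u ≤ 1) {T : ℕ}
    (hT : c.potential k N E < T) :
    Valid k N E c₀ ((Preflow.sweep k N)^[T] c) ∧ ((Preflow.sweep k N)^[T] c).Done k N := by
  have key : ∀ t, Valid k N E c₀ ((Preflow.sweep k N)^[t] c) ∧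
      ((((Preflow.sweep k N)^[t] c).sweep k N = (Preflow.sweep k N)^[t] c ∧
        ((Preflow.sweep k N)^[t] c).Done k N) ∨
      ((Preflow.sweep k N)^[t] c).potential k N E + t ≤ c.potential k N E) := by
    intro t
    induction t with
    | zero => exact ⟨hc, Or.inr le_rfl⟩
    | succ t ih =>
      obtain ⟨i1, i2⟩ := ih
      rw [Function.iterate_succ_apply']
      obtain ⟨j1, j2⟩ := i1.sweep h₀
      refine ⟨j1, ?_⟩
      rcases j2 with ⟨j2, j3⟩ | j2
      · left
        rw [j2]
        exact ⟨j2, j3⟩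
      · rcases i2 with ⟨i2, -⟩ | i2
        · rw [i2] at j2; exact absurd j2 (lt_irrefl _)
        · right; omega
  obtain ⟨h1, h2⟩ := key T
  refine ⟨h1, ?_⟩
  rcases h2 with h2 | h2
  · exact h2.2
  · omega

/-- Sum the conservation law over S. The arcs inside S cancel, since the sum of the two capacities
of a pair never changes; the arcs out of S have residual capacity 0, so all their original capacity
has been used. -/
theorem Valid.sum_ex (hc : Valid k N E c₀ c) {S : Finset ℕ} (hS : S ⊆ Finset.range N)
    (hout : ∀ u ∈ S, ∀ v ∈ Finset.range N \ S, c.cap u v = 0) :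
    ∑ u ∈ S, c.ex u + ∑ u ∈ S, ∑ v ∈ Finset.range N \ S, c₀.cap u v = ∑ u ∈ S, c₀.ex u := by
  have h1 : ∑ u ∈ S, c.ex u + ∑ u ∈ S, ∑ v ∈ Finset.range N, c₀.cap u v =
      ∑ u ∈ S, c₀.ex u + ∑ u ∈ S, ∑ v ∈ Finset.range N, c.cap u v := by
    rw [← Finset.sum_add_distrib, ← Finset.sum_add_distrib]
    exact Finset.sum_congr rfl fun u hu => hc.cons u (Finset.mem_range.1 (hS hu))
  have h2 : ∀ f : ℕ → ℕ → ℕ, ∑ u ∈ S, ∑ v ∈ Finset.range N, f u v =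
      ∑ u ∈ S, ∑ v ∈ Finset.range N \ S, f u v + ∑ u ∈ S, ∑ v ∈ S, f u v := by
    intro f
    rw [← Finset.sum_add_distrib]
    exact Finset.sum_congr rfl fun u _ => (Finset.sum_sdiff hS).symm
  have h3 : ∑ u ∈ S, ∑ v ∈ Finset.range N \ S, c.cap u v = 0 :=
    Finset.sum_eq_zero fun u hu => Finset.sum_eq_zero fun v hv => hout u hu v hv
  have h4 : ∀ f : ℕ → ℕ → ℕ, 2 * ∑ u ∈ S, ∑ v ∈ S, f u v =
      ∑ u ∈ S, ∑ v ∈ S, (f u v + f v u) := by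
    intro f
    simp only [Finset.sum_add_distrib]
    rw [Finset.sum_comm (f := fun u v => f v u)]
    ring
  have h5 : 2 * ∑ u ∈ S, ∑ v ∈ S, c.cap u v = 2 * ∑ u ∈ S, ∑ v ∈ S, c₀.cap u v := by
    rw [h4, h4]
    exact Finset.sum_congr rfl fun u hu => Finset.sum_congr rfl fun v hv =>
      hc.pair u (Finset.mem_range.1 (hS hu)) v (Finset.mem_range.1 (hS hv))
  rw [h2, h2, h3] at h1
  omega

/-- Gap argument: a vertex that is still active sits at height N + 1, so some height between 1 and N
is vacant. The vertices above the gap form a set without residual arcs out of it and with excess at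
least k each, more than k once, against the cut condition. -/
theorem Valid.ex_le (hc : Valid k N E c₀ c) (hd : c.Done k N)
    (hcut : ∀ S ⊆ Finset.range N, ∑ u ∈ S, c₀.ex u ≤
      k * S.card + ∑ u ∈ S, ∑ v ∈ Finset.range N \ S, c₀.cap u v) {u : ℕ} (hu : u < N) :
    c.ex u ≤ k := by
  by_contra hlt
  have htop : c.ht u = N + 1 := by
    have h1 := hc.bound u hu
    have h2 := hd u hu
    omega
  -- There are N candidate heights and only N - 1 vertices other than u.
  obtain ⟨l, hl, hl'⟩ : ∃ l ∈ Finset.Icc 1 N, l ∉ ((Finset.range N).erase u).image c.ht := by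
    apply Finset.exists_mem_notMem_of_card_lt_card
    calc (((Finset.range N).erase u).image c.ht).card ≤ ((Finset.range N).erase u).card :=
          Finset.card_image_le
      _ = N - 1 := by rw [Finset.card_erase_of_mem (Finset.mem_range.2 hu), Finset.card_range]
      _ < _ := by rw [Nat.card_Icc]; omega
  rw [Finset.mem_Icc] at hl
  have hgap : ∀ v < N, c.ht v ≠ l := by
    intro v hv hvl
    by_cases hvu : v = u
    · subst hvu; omega
    · exact hl' (Finset.mem_image.2 ⟨v, by simp [hvu, hv], hvl⟩)
  set S := (Finset.range N).filter fun v => l < c.ht v with hSdef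
  -- A residual arc descends by at most one, so it cannot cross the vacant height l.
  have hS : S ⊆ Finset.range N := Finset.filter_subset _ _
  have h1 := hc.sum_ex hS (by
    intro a ha b hb
    simp only [hSdef, Finset.mem_filter, Finset.mem_range, Finset.mem_sdiff] at ha hb
    by_contra hab
    have h2 := hc.height a ha.1 b hb.1 (by omega)
    have h3 := hgap b hb.1
    have h4 : ¬ l < c.ht b := fun h => hb.2 ⟨hb.1, h⟩
    omega)
  have h2 := hcut S hS
  have h3 : k * S.card < ∑ v ∈ S, c.ex v := by
    rw [mul_comm, ← smul_eq_mul, ← Finset.sum_const]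
    refine Finset.sum_lt_sum (fun v hv => ?_) ⟨u, ?_, by omega⟩
    · simp only [hSdef, Finset.mem_filter, Finset.mem_range] at hv
      exact hc.nonneg v hv.1 (by omega)
    · simp only [hSdef, Finset.mem_filter, Finset.mem_range]
      omega
  omega

/-- If no cut stands in the way, push–relabel ends with all excesses equal to `k`. -/
theorem exact_of_cut (h₀ : ∀ u < N, ∀ v < N, c₀.cap u v + c₀.cap v u ≤ 1)
    (hht : ∀ u, c₀.ht u = 0)
    (hcut : ∀ S ⊆ Finset.range N, ∑ u ∈ S, c₀.ex u ≤
      k * S.card + ∑ u ∈ S, ∑ v ∈ Finset.range N \ S, c₀.cap u v)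
    (hsum : ∑ u ∈ Finset.range N, c₀.ex u = k * N) {T : ℕ}
    (hT : (k * N + 1) * (N * (N + 1)) < T) :
    (∀ u < N, ∀ v < N, ((Preflow.sweep k N)^[T] c₀).cap u v +
      ((Preflow.sweep k N)^[T] c₀).cap v u = c₀.cap u v + c₀.cap v u) ∧
    ∀ u < N, k + ∑ v ∈ Finset.range N, c₀.cap u v =
      c₀.ex u + ∑ v ∈ Finset.range N, ((Preflow.sweep k N)^[T] c₀).cap u v := by
  have hv : Valid k N (k * N) c₀ c₀ := by
    refine ⟨fun u _ v _ _ => by simp [hht], fun u _ => by simp [hht],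
      fun u _ h => by simp [hht] at h, ?_, fun u _ v _ => rfl, fun u _ => rfl⟩
    rw [← hsum]
    exact Finset.sum_le_sum fun u _ => Nat.sub_le _ _
  obtain ⟨h1, h2⟩ := hv.iterate h₀ (T := T) (by simpa [potential, hht] using hT)
  refine ⟨h1.pair, fun u hu => ?_⟩
  have h3 : ∀ v ∈ Finset.range N, ((Preflow.sweep k N)^[T] c₀).ex v ≤ k :=
    fun v hv => h1.ex_le h2 hcut (Finset.mem_range.1 hv)
  have h4 := h1.sum_ex (S := Finset.range N) subset_rfl (by simp)
  have h5 : ∑ v ∈ Finset.range N, ((Preflow.sweep k N)^[T] c₀).ex v =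
      ∑ v ∈ Finset.range N, k := by
    simp only [Finset.sdiff_self, Finset.sum_empty, Finset.sum_const_zero, add_zero] at h4
    rw [h4, hsum]; simp [mul_comm]
  -- All excesses are at most k and their average is k, so all are equal to k.
  have h6 := (Finset.sum_eq_sum_iff_of_le h3).1 h5 u (Finset.mem_range.2 hu)
  have h7 := h1.cons u hu
  rwa [h6] at h7

end Preflow

/-! ### From the final network to a regular weighted graph -/

theorem Finset.sum_of_subset_range_add {n : ℕ} {S : Finset ℕ} (hS : S ⊆ Finset.range (n + n))
    (f : ℕ → ℕ) :
    ∑ u ∈ S, f u = ∑ i ∈ Finset.univ.filter (fun i : Fin n => (i : ℕ) ∈ S), f i +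
      ∑ j ∈ Finset.univ.filter (fun j : Fin n => n + (j : ℕ) ∈ S), f (n + j) := by
  rw [Finset.sum_filter, Finset.sum_filter,
    Fin.sum_univ_eq_sum_range (fun i => if i ∈ S then f i else 0),
    Fin.sum_univ_eq_sum_range (fun j => if n + j ∈ S then f (n + j) else 0),
    ← Finset.sum_range_add (fun u => if u ∈ S then f u else 0), Finset.sum_ite_mem,
    Finset.inter_eq_right.2 hS]

theorem Finset.sum_range_add_self {n : ℕ} (f : ℕ → ℕ) :
    ∑ u ∈ Finset.range (n + n), f u = ∑ i : Fin n, f i + ∑ j : Fin n, f (n + j) := by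
  rw [Finset.sum_range_add, Fin.sum_univ_eq_sum_range f,
    Fin.sum_univ_eq_sum_range (fun j => f (n + j))]

namespace RAM

theorem adjMat_apply {n : ℕ} (G : SimpleGraph (Fin n)) [DecidableRel G.Adj] (u v : Fin n) :
    adjMat G u v = if G.Adj u v then 1 else 0 := by
  have : (∃ a b : Fin n, (a : ℕ) = u ∧ (b : ℕ) = v ∧ G.Adj a b) ↔ G.Adj u v := by
    constructor
    · rintro ⟨a, b, ha, hb, h⟩
      rwa [Fin.ext ha, Fin.ext hb] at h
    · exact fun h => ⟨u, v, rfl, rfl, h⟩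
  simp only [adjMat, State.input, true_and, this]

variable {n k : ℕ} {G : SimpleGraph (Fin n)} {R : ℕ → ℕ → ℕ}

/-- If no cut stands in the way, the computed matrix has line sums `k`. -/
theorem finalNet_spec (hR : ∀ i j : Fin n, R i j ≤ adjMat G i j)
    (hU : ∀ X Y : Finset (Fin n), ∑ i ∈ Xᶜ, ∑ j ∈ Y, R i j + k * X.card ≤
      ∑ i ∈ X, ∑ j ∈ Yᶜ, adjMat G i j + k * Y.card)
    (hk : (k * (n + n) + 1) * ((n + n) * (n + n + 1)) < n ^ 5) :
    (∀ i j : Fin n, R i j + (finalNet G k R).cap (n + j) i ≤ adjMat G i j) ∧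
    (∀ i : Fin n, ∑ j : Fin n, (R i j + (finalNet G k R).cap (n + j) i) = k) ∧
    ∀ j : Fin n, ∑ i : Fin n, (R i j + (finalNet G k R).cap (n + j) i) = k := by
  classical
  set A := adjMat G with hA
  have hA1 : ∀ i j : Fin n, A i j ≤ 1 := by
    intro i j; rw [hA, adjMat_apply]; split_ifs <;> omega
  -- The cut condition for X = {i}ᶜ and Y everything bounds the row sums; hence the subtraction in
  -- the row excesses 2k - ∑ R is not truncated.
  have hrow : ∀ i : Fin n, ∑ j : Fin n, R i j ≤ k := by
    intro i
    have := hU {i}ᶜ Finset.univ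
    simp only [compl_compl, Finset.sum_singleton, Finset.compl_univ, Finset.sum_empty,
      Finset.sum_const_zero, zero_add, Finset.card_compl, Finset.card_singleton, Fintype.card_fin,
      Finset.card_univ] at this
    obtain ⟨m, rfl⟩ : ∃ m, n = m + 1 := ⟨n - 1, by have := i.2; omega⟩
    rw [Nat.add_sub_cancel, mul_add] at this
    omega
  set c₀ := Preflow.initial n k A R with hc₀
  have ex_row : ∀ i : Fin n, c₀.ex i + ∑ j : Fin n, R i j = k + k := by
    intro i
    have h1 := hrow i
    simp only [hc₀, Preflow.initial, i.2, if_true]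
    rw [← Fin.sum_univ_eq_sum_range (fun j => R i j)]
    omega
  have ex_col : ∀ j : Fin n, c₀.ex (n + j) = ∑ i : Fin n, R i j := by
    intro j
    simp only [hc₀, Preflow.initial]
    rw [if_neg (by omega), if_pos (by omega), Nat.add_sub_cancel_left,
      ← Fin.sum_univ_eq_sum_range (fun i => R i j)]
  have cap_rr : ∀ i i' : Fin n, c₀.cap i i' = 0 := by
    intro i i'; simp [hc₀, Preflow.initial]
  have cap_rc : ∀ i j : Fin n, c₀.cap i (n + j) = A i j - R i j := by
    intro i j; simp [hc₀, Preflow.initial]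
  have cap_c : ∀ (j : Fin n) (v : ℕ), c₀.cap (n + j) v = 0 := by
    intro j v; simp [hc₀, Preflow.initial]
  have split : ∀ u < n + n, (∃ i : Fin n, u = i) ∨ ∃ j : Fin n, u = n + j := by
    intro u hu
    by_cases h : u < n
    · exact Or.inl ⟨⟨u, h⟩, rfl⟩
    · exact Or.inr ⟨⟨u - n, by omega⟩, by simp; omega⟩
  have hsumR : ∑ i : Fin n, ∑ j : Fin n, R i j = ∑ j : Fin n, ∑ i : Fin n, R i j :=
    Finset.sum_comm
  have hex : ∀ X : Finset (Fin n), ∑ i ∈ X, c₀.ex i + ∑ i ∈ X, ∑ j : Fin n, R i j =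
      X.card * (k + k) := by
    intro X
    rw [← Finset.sum_add_distrib, Finset.sum_congr rfl fun i _ => ex_row i]
    simp
  obtain ⟨hpair, hcons⟩ := Preflow.exact_of_cut (k := k) (N := n + n) (c₀ := c₀) (T := n ^ 5)
    (by
      intro u hu v hv
      rcases split u hu with ⟨i, rfl⟩ | ⟨i, rfl⟩ <;> rcases split v hv with ⟨j, rfl⟩ | ⟨j, rfl⟩
      · rw [cap_rr, cap_rr]; omega
      · rw [cap_rc, cap_c]; have := hA1 i j; omega
      · rw [cap_rc, cap_c]; have := hA1 j i; omega
      · rw [cap_c, cap_c]; omega)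
    (fun u => rfl)
    (by
      intro S hS
      -- Let S consist of the rows X and the columns Y. After cancelling R(X, Y) and R(X, Yᶜ), the
      -- cut condition of the network is exactly the hypothesis on (X, Y).
      set X := Finset.univ.filter (fun i : Fin n => (i : ℕ) ∈ S) with hX
      set Y := Finset.univ.filter (fun j : Fin n => n + (j : ℕ) ∈ S) with hY
      have hX' : Finset.univ.filter (fun i : Fin n => (i : ℕ) ∈ Finset.range (n + n) \ S) = Xᶜ := by
        ext i; simp [hX]; intro; omega
      have hY' : Finset.univ.filter (fun j : Fin n => n + (j : ℕ) ∈ Finset.range (n + n) \ S) =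
          Yᶜ := by
        ext i; simp [hY]
      have hcard : S.card = X.card + Y.card := by
        have := Finset.sum_of_subset_range_add hS (fun _ => 1)
        simpa using this
      rw [Finset.sum_of_subset_range_add hS, Finset.sum_of_subset_range_add hS, hcard]
      simp only [Finset.sum_of_subset_range_add (Finset.sdiff_subset (s := Finset.range (n + n))
        (t := S)), ← hX, ← hY, hX', hY', cap_c, cap_rr, cap_rc, Finset.sum_const_zero, add_zero,
        zero_add, ex_col]
      have h1 := hex X
      have h2 := hU X Y
      have h3 : ∑ i ∈ X, ∑ j ∈ Yᶜ, (A i j - R i j) + ∑ i ∈ X, ∑ j ∈ Yᶜ, R i j =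
          ∑ i ∈ X, ∑ j ∈ Yᶜ, A i j := by
        simp only [← Finset.sum_add_distrib]
        exact Finset.sum_congr rfl fun i _ => Finset.sum_congr rfl fun j _ =>
          Nat.sub_add_cancel (hR i j)
      have h4 : ∑ i ∈ X, ∑ j : Fin n, R i j =
          ∑ i ∈ X, ∑ j ∈ Y, R i j + ∑ i ∈ X, ∑ j ∈ Yᶜ, R i j := by
        rw [← Finset.sum_add_distrib]
        exact Finset.sum_congr rfl fun i _ => (Finset.sum_add_sum_compl Y _).symm
      have h5 : ∑ j ∈ Y, ∑ i : Fin n, R i j =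
          ∑ i ∈ X, ∑ j ∈ Y, R i j + ∑ i ∈ Xᶜ, ∑ j ∈ Y, R i j := by
        rw [Finset.sum_comm, Finset.sum_add_sum_compl X]
      rw [mul_add] at h1 ⊢
      rw [mul_comm k X.card, mul_comm k Y.card] at h2 ⊢
      omega)
    (by
      rw [Finset.sum_range_add_self]
      simp only [ex_col]
      have := hex Finset.univ
      simp only [Finset.card_univ, Fintype.card_fin] at this
      rw [← hsumR, this]; ring)
    hk
  have hpair' : ∀ i j : Fin n, (finalNet G k R).cap i (n + j) + (finalNet G k R).cap (n + j) i =
      A i j - R i j := by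
    intro i j
    rw [← cap_rc, ← add_zero (c₀.cap i (n + j)), ← cap_c j i]
    exact hpair i (by omega) (n + j) (by omega)
  refine ⟨?_, ?_, ?_⟩
  · intro i j
    have h1 := hpair' i j
    have h2 := hR i j
    omega
  · intro i
    have h1 := hcons i (by omega)
    rw [Finset.sum_range_add_self, Finset.sum_range_add_self] at h1
    simp only [cap_rr, cap_rc, Finset.sum_const_zero, zero_add] at h1
    -- Capacities between two rows start at 0, and their pair sums are preserved.
    have h2 : ∑ j : Fin n, (finalNet G k R).cap i j = 0 := by
      refine Finset.sum_eq_zero fun j _ => ?_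
      have := hpair i (by omega) j (by omega)
      rw [cap_rr, cap_rr] at this
      exact (Nat.add_eq_zero_iff.1 this).1
    have h3 : ∑ j : Fin n, (finalNet G k R).cap i (n + j) +
        ∑ j : Fin n, (finalNet G k R).cap (n + j) i = ∑ j : Fin n, (A i j - R i j) := by
      rw [← Finset.sum_add_distrib]
      exact Finset.sum_congr rfl fun j _ => hpair' i j
    have h4 := ex_row i
    rw [Finset.sum_add_distrib]
    change _ = c₀.ex i + (∑ j : Fin n, (finalNet G k R).cap i j +
      ∑ j : Fin n, (finalNet G k R).cap i (n + j)) at h1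
    omega
  · intro j
    have h1 := hcons (n + j) (by omega)
    rw [Finset.sum_range_add_self, Finset.sum_range_add_self] at h1
    simp only [cap_c, Finset.sum_const_zero, add_zero, ex_col] at h1
    have h2 : ∑ i : Fin n, (finalNet G k R).cap (n + j) (n + i) = 0 := by
      refine Finset.sum_eq_zero fun i _ => ?_
      have := hpair (n + j) (by omega) (n + i) (by omega)
      rw [cap_c, cap_c] at this
      exact (Nat.add_eq_zero_iff.1 this).1
    rw [Finset.sum_add_distrib]
    change _ = _ + (∑ i : Fin n, (finalNet G k R).cap (n + j) i +
      ∑ i : Fin n, (finalNet G k R).cap (n + j) (n + i)) at h1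
    omega

/-- A zero-one matrix below the adjacency matrix plus its transpose, as a weighted graph. -/
noncomputable def symGraph (G : SimpleGraph (Fin n)) (M : Fin n → Fin n → ℕ)
    (hM : ∀ i j, M i j ≤ adjMat G i j) : WeightedGraph (Fin n) where
  weight u v := ((M u v + M v u : ℕ) : ℝ)
  nonneg u v := Nat.cast_nonneg _
  symm u v := by rw [add_comm]
  loopless v := by
    classical
    have h := hM v v
    rw [adjMat_apply, if_neg (G.loopless.irrefl v)] at h
    simp [Nat.le_zero.1 h]

/-- Row and column sums k add up to degree 2k, and a zero-one matrix plus its transpose has entries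
at most 2. Half of the cut, the part from M itself, already gives expansion 1. -/
theorem symGraph_isSparseExpandingSubgraph (hn : 2 ≤ n) {M : Fin n → Fin n → ℕ}
    (hM : ∀ i j, M i j ≤ adjMat G i j) (hrow : ∀ i, ∑ j, M i j = k) (hcol : ∀ j, ∑ i, M i j = k)
    (hL : ∀ S : Finset (Fin n), 0 < S.card → 2 * S.card ≤ n →
      S.card ≤ ∑ i ∈ S, ∑ j ∈ Sᶜ, M i j) {s : ℝ} (hs : ((k + k : ℕ) : ℝ) ≤ s) :
    IsSparseExpandingSubgraph s G (symGraph G M hM) := by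
  classical
  have hle : ∀ u v, M u v ≤ if G.Adj u v then 1 else 0 := fun u v => by
    rw [← adjMat_apply]; exact hM u v
  have hadj : ∀ u v, M u v + M v u ≠ 0 → G.Adj u v := by
    intro u v h
    by_contra hc
    have h1 := hle u v
    have h2 := hle v u
    rw [if_neg hc] at h1
    rw [if_neg (fun h => hc h.symm)] at h2
    omega
  have hw : ∀ u v, (symGraph G M hM).weight u v = ((M u v + M v u : ℕ) : ℝ) := fun _ _ => rfl
  refine ⟨?_, ?_, ⟨k + k, ?_, hs⟩, ?_⟩
  · intro u v h
    exact hadj u v (fun h' => h (by rw [hw, h', Nat.cast_zero]))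
  · intro u v h
    have h0 : M u v + M v u ≠ 0 := fun h' => h (by rw [hw, h', Nat.cast_zero])
    have h1 : M u v ≤ 1 := (hle u v).trans (by split_ifs <;> omega)
    have h2 : M v u ≤ 1 := (hle v u).trans (by split_ifs <;> omega)
    have h3 : M u v + M v u = 1 ∨ M u v + M v u = 2 := by omega
    rcases h3 with h3 | h3
    · left; rw [hw, h3, Nat.cast_one]
    · right; rw [hw, h3, Nat.cast_ofNat]
  · intro v
    simp only [symGraph]
    rw [← Nat.cast_sum, Finset.sum_add_distrib, hrow, hcol]
  · refine le_csInf ?_ ?_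
    · exact ⟨_, {⟨0, by omega⟩}, by simp, by simpa using hn, rfl⟩
    · rintro x ⟨S, h1, h2, rfl⟩
      rw [Fintype.card_fin] at h2
      have h3 := hL S h1 h2
      have h4 : (S.card : ℝ) ≤ (symGraph G M hM).cutWeight S := by
        calc (S.card : ℝ) ≤ ((∑ i ∈ S, ∑ j ∈ Sᶜ, M i j : ℕ) : ℝ) := by exact_mod_cast h3
          _ ≤ ((∑ i ∈ S, ∑ j ∈ Sᶜ, (M i j + M j i) : ℕ) : ℝ) := by
            exact_mod_cast Finset.sum_le_sum fun i _ => Finset.sum_le_sum fun j _ =>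
              Nat.le_add_right _ _
          _ = _ := by simp [WeightedGraph.cutWeight, symGraph]
      have h5 : (0 : ℝ) < S.card := by exact_mod_cast h1
      rw [le_div_iff₀ h5]
      linarith

end RAM

/-! ### Small cuts in the bipartite double cover -/

open scoped symmDiff

namespace SimpleGraph

variable {V : Type*} (G : SimpleGraph V) [DecidableRel G.Adj]

/-- The number of ordered pairs of adjacent vertices in `X × Y`. -/
def edgeCount (X Y : Finset V) : ℕ := ∑ u ∈ X, ∑ v ∈ Y, if G.Adj u v then 1 else 0

theorem edgeCount_comm (X Y : Finset V) : G.edgeCount X Y = G.edgeCount Y X := by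
  unfold edgeCount
  rw [Finset.sum_comm]
  simp only [G.adj_comm]

theorem edgeCount_mono {X Y X' Y' : Finset V} (hX : X ⊆ X') (hY : Y ⊆ Y') :
    G.edgeCount X Y ≤ G.edgeCount X' Y' :=
  (Finset.sum_le_sum_of_subset hX).trans
    (Finset.sum_le_sum fun _ _ => Finset.sum_le_sum_of_subset hY)

theorem edgeCount_union_right [DecidableEq V] {X Y Z : Finset V} (h : Disjoint Y Z) :
    G.edgeCount X (Y ∪ Z) = G.edgeCount X Y + G.edgeCount X Z := by
  simp only [edgeCount, Finset.sum_union h, Finset.sum_add_distrib]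

variable [Fintype V] [DecidableEq V]

/-- The number of edges of the bipartite double cover that leave `X` (on the left) and `Y` (on the
right). -/
def discrepancy (X Y : Finset V) : ℕ :=
  ∑ u, ∑ v, if G.Adj u v ∧ ¬ (u ∈ X ↔ v ∈ Y) then 1 else 0

theorem edgeCount_add_compl_right (X Y : Finset V) :
    G.edgeCount X Y + G.edgeCount X Yᶜ = ∑ u ∈ X, G.degree u := by
  rw [← edgeCount_union_right _ disjoint_compl_right, Finset.union_compl]
  refine Finset.sum_congr rfl fun u _ => ?_
  rw [← Finset.card_filter, ← G.card_neighborFinset_eq_degree]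
  congr 1
  ext v
  simp

theorem discrepancy_eq (X Y : Finset V) :
    G.discrepancy X Y = G.edgeCount X Yᶜ + G.edgeCount Xᶜ Y := by
  unfold discrepancy edgeCount
  rw [← Finset.sum_add_sum_compl X]
  congr 1
  · refine Finset.sum_congr rfl fun u hu => ?_
    rw [← Finset.sum_add_sum_compl Y, Finset.sum_eq_zero, zero_add]
    · refine Finset.sum_congr rfl fun v hv => ?_
      simp [hu, Finset.mem_compl.1 hv]
    · intro v hv; simp [hu, hv]
  · refine Finset.sum_congr rfl fun u hu => ?_
    rw [← Finset.sum_add_sum_compl Y, add_comm, Finset.sum_eq_zero, zero_add]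
    · refine Finset.sum_congr rfl fun v hv => ?_
      simp [hv, Finset.mem_compl.1 hu]
    · intro v hv; simp [Finset.mem_compl.1 hu, Finset.mem_compl.1 hv]

theorem discrepancy_compl (X Y : Finset V) : G.discrepancy Xᶜ Yᶜ = G.discrepancy X Y := by
  simp only [discrepancy_eq, compl_compl]
  ring

/-- Edge boundaries are additive modulo 2: an edge in the boundary of a symmetric difference is in
exactly one of the two boundaries. -/
theorem discrepancy_symmDiff_le (X Y X' Y' : Finset V) :
    G.discrepancy (X ∆ X') (Y ∆ Y') ≤ G.discrepancy X Y + G.discrepancy X' Y' := by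
  simp only [discrepancy, ← Finset.sum_add_distrib]
  refine Finset.sum_le_sum fun u _ => Finset.sum_le_sum fun v _ => ?_
  by_cases h : G.Adj u v <;> by_cases h1 : u ∈ X <;> by_cases h2 : u ∈ X' <;>
    by_cases h3 : v ∈ Y <;> by_cases h4 : v ∈ Y' <;> simp [Finset.mem_symmDiff, h, h1, h2, h3, h4]

/-- Edges from outside X ∪ Y into Y leave Y in the double cover; those into X \ Y, read backwards,
leave X. This transfers expansion from G to its double cover. -/
theorem edgeCount_compl_le_discrepancy (X Y : Finset V) :
    G.edgeCount (X ∪ Y)ᶜ (X ∪ Y) ≤ G.discrepancy X Y := by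
  have h1 : X ∪ Y = Y ∪ (X \ Y) := by
    rw [Finset.union_sdiff_self_eq_union, Finset.union_comm]
  have h2 : G.edgeCount (X ∪ Y)ᶜ (X ∪ Y) =
      G.edgeCount (X ∪ Y)ᶜ Y + G.edgeCount (X ∪ Y)ᶜ (X \ Y) := by
    conv_lhs => rw [h1]
    rw [edgeCount_union_right _ Finset.disjoint_sdiff, ← h1]
  rw [h2, discrepancy_eq, add_comm, edgeCount_comm _ _ (X \ Y)]
  refine add_le_add (G.edgeCount_mono Finset.sdiff_subset ?_) (G.edgeCount_mono ?_ subset_rfl)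
  · exact Finset.compl_subset_compl.2 Finset.subset_union_right
  · exact Finset.compl_subset_compl.2 Finset.subset_union_left

variable {G} {c : ℝ}

theorem expansion_min (hexp : ∀ S : Finset V, 2 * S.card ≤ Fintype.card V →
    c * S.card ≤ G.edgeCount S Sᶜ) (T : Finset V) :
    c * T.card ≤ G.edgeCount Tᶜ T ∨ c * Tᶜ.card ≤ G.edgeCount Tᶜ T := by
  have h := Finset.card_add_card_compl T
  rcases le_total (2 * T.card) (Fintype.card V) with h1 | h1
  · left
    rw [edgeCount_comm]
    exact hexp T h1
  · right
    have := hexp Tᶜ (by omega)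
    rwa [compl_compl] at this

/-- A set with small boundary in the double cover is near the empty set, near everything, or is
nearly a bipartition. -/
theorem discrepancy_trichotomy (hc : 0 ≤ c) (hexp : ∀ S : Finset V,
    2 * S.card ≤ Fintype.card V → c * S.card ≤ G.edgeCount S Sᶜ) (X Y : Finset V) :
    c * (X.card + Y.card) ≤ 2 * G.discrepancy X Y ∨
    c * (Xᶜ.card + Yᶜ.card) ≤ 2 * G.discrepancy X Y ∨
    (c * (X ∪ Y)ᶜ.card ≤ G.discrepancy X Y ∧ c * (X ∩ Y).card ≤ G.discrepancy X Y) := by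
  -- If the union is the small side of its cut, then X and Y are both small; otherwise the
  -- complement of the union is small. The same alternative for the complements of X and Y controls
  -- the intersection.
  have key : ∀ X Y : Finset V, c * (X.card + Y.card) ≤ 2 * G.discrepancy X Y ∨
      c * (X ∪ Y)ᶜ.card ≤ G.discrepancy X Y := by
    intro X Y
    have h1 : (G.edgeCount (X ∪ Y)ᶜ (X ∪ Y) : ℝ) ≤ G.discrepancy X Y := by
      exact_mod_cast G.edgeCount_compl_le_discrepancy X Y
    rcases expansion_min hexp (X ∪ Y) with h2 | h2
    · left
      have h3 : (X.card : ℝ) ≤ (X ∪ Y).card := by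
        exact_mod_cast Finset.card_le_card Finset.subset_union_left
      have h4 : (Y.card : ℝ) ≤ (X ∪ Y).card := by
        exact_mod_cast Finset.card_le_card Finset.subset_union_right
      have h5 := mul_le_mul_of_nonneg_left h3 hc
      have h6 := mul_le_mul_of_nonneg_left h4 hc
      linarith
    · right; linarith
  rcases key X Y with h1 | h1
  · exact Or.inl h1
  · have h2 := key Xᶜ Yᶜ
    rw [discrepancy_compl, Finset.compl_union, compl_compl, compl_compl] at h2
    rcases h2 with h2 | h2
    · exact Or.inr (Or.inl h2)
    · exact Or.inr (Or.inr ⟨h1, h2⟩)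

theorem _root_.Finset.compl_symmDiff_eq (X Y : Finset V) : (X ∆ Y)ᶜ = X ∆ Yᶜ := by
  ext u
  simp only [Finset.mem_compl, Finset.mem_symmDiff]
  tauto

/-- In the double cover of an expander, each set is within a distance that is proportional to its
boundary from one of at most four sets. -/
theorem exists_centers (hc : 0 ≤ c) (hexp : ∀ S : Finset V,
    2 * S.card ≤ Fintype.card V → c * S.card ≤ G.edgeCount S Sᶜ) :
    ∃ X₀ Y₀ : Finset V, ∀ X Y : Finset V,
      ∃ p ∈ ({(∅, ∅), (Finset.univ, Finset.univ), (X₀, Y₀), (X₀ᶜ, Y₀ᶜ)} :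
          Finset (Finset V × Finset V)),
        c * ((X ∆ p.1).card + (Y ∆ p.2).card : ℕ) ≤ 32 * G.discrepancy X Y := by
  classical
  let P : Finset V × Finset V → Prop := fun p => c * (p.1 ∪ p.2)ᶜ.card ≤ G.discrepancy p.1 p.2 ∧
    c * (p.1 ∩ p.2).card ≤ G.discrepancy p.1 p.2
  -- The centre is a near-bipartition of least discrepancy, so its discrepancy can be charged to
  -- that of any other one. If there is none, the default pair is never compared with anything.
  obtain ⟨p₀, hp₀⟩ : ∃ p₀ : Finset V × Finset V, ∀ p, P p →
      P p₀ ∧ G.discrepancy p₀.1 p₀.2 ≤ G.discrepancy p.1 p.2 := by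
    by_cases hne : ((Finset.univ : Finset (Finset V × Finset V)).filter P).Nonempty
    · obtain ⟨p₀, h1, h2⟩ := Finset.exists_min_image _ (fun p => G.discrepancy p.1 p.2) hne
      exact ⟨p₀, fun p hp => ⟨(Finset.mem_filter.1 h1).2, h2 p (by simp [hp])⟩⟩
    · refine ⟨(∅, ∅), fun p hp => absurd ⟨p, by simp [hp]⟩ hne⟩
  obtain ⟨X₀, Y₀⟩ := p₀
  refine ⟨X₀, Y₀, fun X Y => ?_⟩
  have hd : (0 : ℝ) ≤ G.discrepancy X Y := Nat.cast_nonneg _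
  rcases discrepancy_trichotomy hc hexp X Y with h | h | h
  · refine ⟨(∅, ∅), by simp, ?_⟩
    have e1 : ∀ X : Finset V, X ∆ ∅ = X := fun X => by ext; simp [Finset.mem_symmDiff]
    simp only [e1]
    push_cast
    linarith
  · refine ⟨(Finset.univ, Finset.univ), by simp, ?_⟩
    have e1 : ∀ X : Finset V, X ∆ Finset.univ = Xᶜ := fun X => by ext; simp [Finset.mem_symmDiff]
    simp only [e1]
    push_cast
    linarith
  obtain ⟨⟨h1, h2⟩, h3⟩ := hp₀ (X, Y) h
  simp only at h1 h2 h3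
  obtain ⟨h4, h5⟩ := h
  have h3' : (G.discrepancy X₀ Y₀ : ℝ) ≤ G.discrepancy X Y := by exact_mod_cast h3
  have h6 : (G.discrepancy (X ∆ X₀) (Y ∆ Y₀) : ℝ) ≤ 2 * G.discrepancy X Y := by
    have : (G.discrepancy (X ∆ X₀) (Y ∆ Y₀) : ℝ) ≤ G.discrepancy X Y + G.discrepancy X₀ Y₀ := by
      exact_mod_cast G.discrepancy_symmDiff_le X Y X₀ Y₀
    linarith
  rcases discrepancy_trichotomy hc hexp (X ∆ X₀) (Y ∆ Y₀) with h | h | ⟨h7, h8⟩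
  · refine ⟨(X₀, Y₀), by simp, ?_⟩
    push_cast
    linarith
  · refine ⟨(X₀ᶜ, Y₀ᶜ), by simp, ?_⟩
    rw [Finset.compl_symmDiff_eq, Finset.compl_symmDiff_eq] at h
    push_cast
    linarith
  -- Three near-bipartitions cannot coexist. A vertex in exactly one of X, Y and in exactly one of
  -- X₀, Y₀ is in both or neither of the symmetric differences. So the six exceptional sets cover V,
  -- hence c·|V| ≤ 8·discrepancy, and then even the empty pair is close enough.
  · have hn : (Fintype.card V : ℝ) ≤ (X ∪ Y)ᶜ.card + (X ∩ Y).card + ((X₀ ∪ Y₀)ᶜ.card +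
        (X₀ ∩ Y₀).card) + ((X ∆ X₀ ∪ Y ∆ Y₀)ᶜ.card + (X ∆ X₀ ∩ Y ∆ Y₀).card) := by
      have hsub : (Finset.univ : Finset V) ⊆ (X ∪ Y)ᶜ ∪ (X ∩ Y) ∪ ((X₀ ∪ Y₀)ᶜ ∪ (X₀ ∩ Y₀)) ∪
          ((X ∆ X₀ ∪ Y ∆ Y₀)ᶜ ∪ (X ∆ X₀ ∩ Y ∆ Y₀)) := by
        intro u _
        simp only [Finset.mem_union, Finset.mem_compl, Finset.mem_inter, Finset.mem_symmDiff]
        tauto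
      have hcard := Finset.card_le_card hsub
      rw [Finset.card_univ] at hcard
      have u1 := Finset.card_union_le ((X ∪ Y)ᶜ ∪ (X ∩ Y) ∪ ((X₀ ∪ Y₀)ᶜ ∪ (X₀ ∩ Y₀)))
        ((X ∆ X₀ ∪ Y ∆ Y₀)ᶜ ∪ (X ∆ X₀ ∩ Y ∆ Y₀))
      have u2 := Finset.card_union_le ((X ∪ Y)ᶜ ∪ (X ∩ Y)) ((X₀ ∪ Y₀)ᶜ ∪ (X₀ ∩ Y₀))
      have u3 := Finset.card_union_le (X ∪ Y)ᶜ (X ∩ Y)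
      have u4 := Finset.card_union_le (X₀ ∪ Y₀)ᶜ (X₀ ∩ Y₀)
      have u5 := Finset.card_union_le (X ∆ X₀ ∪ Y ∆ Y₀)ᶜ (X ∆ X₀ ∩ Y ∆ Y₀)
      exact_mod_cast (by omega)
    have hcn := mul_le_mul_of_nonneg_left hn hc
    refine ⟨(∅, ∅), by simp, ?_⟩
    have h9 : ((X ∆ ∅).card + (Y ∆ ∅).card : ℕ) ≤ (2 * Fintype.card V : ℝ) := by
      have u1 := Finset.card_le_univ (X ∆ ∅)
      have u2 := Finset.card_le_univ (Y ∆ ∅)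
      exact_mod_cast (by omega)
    have h10 := mul_le_mul_of_nonneg_left h9 hc
    linarith

end SimpleGraph

/-! ### Tail bounds for the number of kept entries -/

namespace RAM

/-- The number of blocks in `Q` all of whose coins show heads. -/
def hits {n : ℕ} (ω : ℕ → Bool) (b : ℕ) (Q : Finset (Fin n × Fin n)) : ℕ :=
  ∑ e ∈ Q, hit ω b (e.1 * n + e.2)

/-- Exact moment generating function: different entries read disjoint blocks of b coins, so the sum
over coin sequences factorizes, and one of the 2 ^ b outcomes of a block is a hit. Coins beyond the
blocks only contribute to the power of two. -/
theorem sum_pow_hits {T n b : ℕ} (hT : n * n * b ≤ T) (Q : Finset (Fin n × Fin n)) (x : ℝ) :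
    ∑ r : Fin T → Bool, x ^ hits (coins r) b Q = 2 ^ T * (1 + (x - 1) / 2 ^ b) ^ Q.card := by
  obtain ⟨d, rfl⟩ := Nat.exists_eq_add_of_le hT
  let e : ((Fin n × Fin n) × Fin b) ⊕ Fin d ≃ Fin (n * n * b + d) :=
    (((finProdFinEquiv.prodCongr (Equiv.refl _)).trans finProdFinEquiv).sumCongr
      (Equiv.refl _)).trans finSumFinEquiv
  -- Coin sequences are regrouped into one block per entry and a remainder.
  let e' : ((Fin n × Fin n → Fin b → Bool) × (Fin d → Bool)) ≃ (Fin (n * n * b + d) → Bool) :=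
    (((Equiv.curry _ _ _).symm.prodCongr (Equiv.refl _)).trans
      (Equiv.sumArrowEquivProdArrow _ _ _).symm).trans (e.arrowCongr (Equiv.refl _))
  have hhit : ∀ (f : (Fin n × Fin n → Fin b → Bool) × (Fin d → Bool)) (m : Fin n × Fin n),
      hit (coins (e' f)) b (m.1 * n + m.2) = if ∀ c, f.1 m c = true then 1 else 0 := by
    intro f m
    unfold hit
    congr 1
    rw [eq_iff_iff, ← Fin.forall_iff (p := fun c => coins (e' f) ((m.1 * n + m.2) * b + c) = true)]
    refine forall_congr' fun c => ?_
    have hval : ((e (Sum.inl (m, c))) : ℕ) = (m.1 * n + m.2) * b + c := by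
      simp [e, finProdFinEquiv_apply_val]
      ring
    have : coins (e' f) ((m.1 * n + m.2) * b + c) = f.1 m c := by
      rw [← hval, coins, dif_pos (e (Sum.inl (m, c))).2]
      simp only [e', Equiv.trans_apply, Equiv.arrowCongr_apply, Function.comp_apply,
        Fin.eta, Equiv.symm_apply_apply]
      rfl
    rw [this]
  rw [← Equiv.sum_comp e', Fintype.sum_prod_type]
  have hterm : ∀ (f : Fin n × Fin n → Fin b → Bool) (g : Fin d → Bool),
      x ^ hits (coins (e' (f, g))) b Q =
        ∏ m, if m ∈ Q then (if ∀ c, f m c = true then x else 1) else 1 := by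
    intro f g
    rw [hits, ← Finset.prod_pow_eq_pow_sum, Finset.prod_ite_mem, Finset.univ_inter]
    refine Finset.prod_congr rfl fun m _ => ?_
    rw [hhit]
    split_ifs <;> simp
  simp only [hterm, Finset.sum_const, Finset.card_univ, Fintype.card_pi, Fintype.card_bool,
    Finset.prod_const, Fintype.card_fin, nsmul_eq_mul]
  have hprod := Finset.prod_univ_sum (fun _ : Fin n × Fin n => (Finset.univ : Finset (Fin b → Bool)))
    (fun m y => if m ∈ Q then (if ∀ c, y c = true then x else 1) else (1 : ℝ))
  rw [Fintype.piFinset_univ] at hprod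
  rw [← Finset.mul_sum, ← hprod]
  have hone : ∑ y : Fin b → Bool, (if ∀ c, y c = true then x else 1) = 2 ^ b * (1 + (x - 1) / 2 ^ b) := by
    have : ∀ y : Fin b → Bool, (if ∀ c, y c = true then x else 1) =
        1 + if y = (fun _ => true) then x - 1 else 0 := by
      intro y
      simp only [funext_iff]
      split_ifs <;> ring
    simp only [this, Finset.sum_add_distrib, Finset.sum_ite_eq', Finset.mem_univ, if_true]
    simp
    field_simp
  have hfac : ∀ m : Fin n × Fin n, (∑ y : Fin b → Bool, if m ∈ Q then
      (if ∀ c, y c = true then x else 1) else (1 : ℝ)) =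
      2 ^ b * if m ∈ Q then (1 + (x - 1) / 2 ^ b) else 1 := by
    intro m
    split_ifs with h
    · exact hone
    · simp
  simp only [hfac, Finset.prod_mul_distrib, Finset.prod_ite_mem, Finset.univ_inter,
    Finset.prod_const, Finset.card_univ, Fintype.card_prod, Fintype.card_fin]
  push_cast
  rw [← pow_mul, pow_add, mul_comm b (n * n)]
  ring

/-- Markov's inequality for 2 ^ hits. -/
theorem card_le_hits {T n b : ℕ} (hT : n * n * b ≤ T) (Q : Finset (Fin n × Fin n)) (m : ℕ) :
    ((Finset.univ.filter fun r : Fin T → Bool => m ≤ hits (coins r) b Q).card : ℝ) ≤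
      2 ^ T * ((1 / 2) ^ m * Real.exp (Q.card / 2 ^ b)) := by
  have h1 : ((Finset.univ.filter fun r : Fin T → Bool => m ≤ hits (coins r) b Q).card : ℝ) * 2 ^ m ≤
      ∑ r : Fin T → Bool, (2 : ℝ) ^ hits (coins r) b Q := by
    rw [← nsmul_eq_mul, ← Finset.sum_const]
    refine (Finset.sum_le_sum fun r hr => ?_).trans
      (Finset.sum_le_univ_sum_of_nonneg fun r => by positivity)
    exact pow_le_pow_right₀ (by norm_num) (Finset.mem_filter.1 hr).2
  rw [sum_pow_hits hT] at h1
  have h2 : (1 + (2 - 1) / 2 ^ b : ℝ) ^ Q.card ≤ Real.exp (Q.card / 2 ^ b) := by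
    rw [div_eq_mul_inv (Q.card : ℝ), Real.exp_nat_mul]
    refine pow_le_pow_left₀ (by positivity) ?_ _
    have := Real.add_one_le_exp ((2 ^ b : ℝ)⁻¹)
    rw [div_eq_mul_inv]
    linarith
  have h3 : (2 : ℝ) ^ m * (1 / 2) ^ m = 1 := by rw [← mul_pow]; norm_num
  calc _ = (((Finset.univ.filter fun r : Fin T → Bool => m ≤ hits (coins r) b Q).card : ℝ) * 2 ^ m) *
        (1 / 2) ^ m := by rw [mul_assoc, h3, mul_one]
    _ ≤ (2 ^ T * Real.exp (Q.card / 2 ^ b)) * (1 / 2) ^ m := by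
      refine mul_le_mul_of_nonneg_right (h1.trans ?_) (by positivity)
      exact mul_le_mul_of_nonneg_left h2 (by positivity)
    _ = _ := by ring

/-- Markov's inequality for (1/2) ^ hits. -/
theorem card_hits_le {T n b : ℕ} (hT : n * n * b ≤ T) (Q : Finset (Fin n × Fin n)) (m : ℕ) :
    ((Finset.univ.filter fun r : Fin T → Bool => hits (coins r) b Q ≤ m).card : ℝ) ≤
      2 ^ T * (2 ^ m * Real.exp (-(Q.card / (2 * 2 ^ b)))) := by
  have h1 : ((Finset.univ.filter fun r : Fin T → Bool => hits (coins r) b Q ≤ m).card : ℝ) *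
      (1 / 2) ^ m ≤ ∑ r : Fin T → Bool, (1 / 2 : ℝ) ^ hits (coins r) b Q := by
    rw [← nsmul_eq_mul, ← Finset.sum_const]
    refine (Finset.sum_le_sum fun r hr => ?_).trans
      (Finset.sum_le_univ_sum_of_nonneg fun r => by positivity)
    exact pow_le_pow_of_le_one (by norm_num) (by norm_num) (Finset.mem_filter.1 hr).2
  rw [sum_pow_hits hT] at h1
  have h2 : (1 + (1 / 2 - 1) / 2 ^ b : ℝ) ^ Q.card ≤ Real.exp (-(Q.card / (2 * 2 ^ b))) := by
    have hb : (1 : ℝ) ≤ 2 ^ b := one_le_pow₀ (by norm_num)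
    have hinv : ((2 : ℝ) ^ b)⁻¹ ≤ 1 := inv_le_one_of_one_le₀ hb
    have e : (-(Q.card / (2 * 2 ^ b)) : ℝ) = Q.card * (-(1 / 2 * (2 ^ b)⁻¹)) := by
      rw [div_eq_mul_inv, mul_inv]; ring
    rw [e, Real.exp_nat_mul]
    refine pow_le_pow_left₀ ?_ ?_ _
    · rw [div_eq_mul_inv]; linarith
    · have := Real.add_one_le_exp (-(1 / 2 * ((2 : ℝ) ^ b)⁻¹))
      rw [div_eq_mul_inv]
      linarith
  have h3 : (1 / 2 : ℝ) ^ m * 2 ^ m = 1 := by rw [← mul_pow]; norm_num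
  calc _ = (((Finset.univ.filter fun r : Fin T → Bool => hits (coins r) b Q ≤ m).card : ℝ) *
        (1 / 2) ^ m) * 2 ^ m := by rw [mul_assoc, h3, mul_one]
    _ ≤ (2 ^ T * Real.exp (-(Q.card / (2 * 2 ^ b)))) * 2 ^ m := by
      refine mul_le_mul_of_nonneg_right (h1.trans ?_) (by positivity)
      exact mul_le_mul_of_nonneg_left h2 (by positivity)
    _ = _ := by ring

end RAM

/-! ### Union bounds over bad cuts and non-expanding sets -/

theorem Finset.sum_pow_card_univ {V : Type*} [Fintype V] (τ : ℝ) :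
    ∑ X : Finset V, τ ^ X.card = (1 + τ) ^ Fintype.card V := by
  have := Fintype.sum_pow_mul_eq_add_pow V τ 1
  simpa [add_comm] using this

/-- Symmetric difference with a fixed set permutes the subsets, so the centre is irrelevant. -/
theorem Finset.sum_pow_card_symmDiff {V : Type*} [Fintype V] [DecidableEq V] (τ : ℝ)
    (p : Finset V × Finset V) :
    ∑ q : Finset V × Finset V, τ ^ ((q.1 ∆ p.1).card + (q.2 ∆ p.2).card) =
      (1 + τ) ^ (2 * Fintype.card V) := by
  have h : ∀ p : Finset V, ∑ X : Finset V, τ ^ (X ∆ p).card = (1 + τ) ^ Fintype.card V := by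
    intro p
    rw [← Finset.sum_pow_card_univ]
    exact Equiv.sum_comp (Function.Involutive.toPerm (fun X : Finset V => X ∆ p)
      (fun X => symmDiff_symmDiff_cancel_right p X)) (fun X => τ ^ X.card)
  rw [Fintype.sum_prod_type]
  simp only [pow_add, ← Finset.mul_sum, ← Finset.sum_mul, h]
  ring

namespace RAM

variable {n T b k D : ℕ} {G : SimpleGraph (Fin n)} [DecidableRel G.Adj]

theorem sum_adjMat (X Y : Finset (Fin n)) :
    ∑ i ∈ X, ∑ j ∈ Y, adjMat G i j = G.edgeCount X Y := by
  simp only [adjMat_apply, SimpleGraph.edgeCount]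

theorem sum_sample (ω : ℕ → Bool) (X Y : Finset (Fin n)) :
    ∑ i ∈ X, ∑ j ∈ Y, sample ω n b (adjMat G) i j =
      hits ω b ((X ×ˢ Y).filter fun e => G.Adj e.1 e.2) := by
  rw [hits, Finset.sum_filter, Finset.sum_product]
  refine Finset.sum_congr rfl fun i _ => Finset.sum_congr rfl fun j _ => ?_
  simp only [sample, adjMat_apply]
  split_ifs <;> simp

theorem card_filter_adj (X Y : Finset (Fin n)) :
    ((X ×ˢ Y).filter fun e => G.Adj e.1 e.2).card = G.edgeCount X Y := by
  rw [Finset.card_filter, Finset.sum_product]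
  rfl

/-- The coin sequences for which the pair `(X, Y)` stands in the way of regularity. -/
def badCut (G : SimpleGraph (Fin n)) [DecidableRel G.Adj] (T b k : ℕ)
    (p : Finset (Fin n) × Finset (Fin n)) : Finset (Fin T → Bool) :=
  Finset.univ.filter fun r =>
    G.edgeCount p.1 p.2ᶜ + k * p.2.card <
      hits (coins r) b ((p.1ᶜ ×ˢ p.2).filter fun e => G.Adj e.1 e.2) + k * p.1.card

/-- For |Y| > |X| put N = A(Xᶜ, Y) and N' = A(X, Yᶜ), so N = N' + (|Y| - |X|)D. A violation needs m
> N' + k(|Y| - |X|) ≥ kN/D hits among N pairs, far above the mean. Since N ≥ D and 2N is at least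
the discrepancy, the exponent pays both for a fixed factor and for the distance d to a centre. -/
theorem card_badCut_le {L q : ℕ} {γ : ℝ} (hT : n * n * b ≤ T) (hreg : ∀ v, G.degree v = D)
    (hD : 0 < D) (hkD : k ≤ D) (hDn : D ≤ n) (hk : k = L * q) (hL : 10 ≤ L)
    (hb : n ≤ q * 2 ^ b) (p : Finset (Fin n) × Finset (Fin n)) {d : ℕ}
    (hd : γ * D * d ≤ 32 * G.discrepancy p.1 p.2) :
    ((badCut G T b k p).card : ℝ) ≤
      2 ^ T * (Real.exp (-(k / 8)) * Real.exp (-(k * γ / 256)) ^ d) := by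
  obtain ⟨X, Y⟩ := p
  simp only at hd
  set N := G.edgeCount Xᶜ Y with hN
  set N' := G.edgeCount X Yᶜ with hN'
  have hX : G.edgeCount X Y + N' = X.card * D := by
    rw [hN', SimpleGraph.edgeCount_add_compl_right, Finset.sum_congr rfl fun v _ => hreg v]
    simp
  have hY : G.edgeCount X Y + N = Y.card * D := by
    rw [hN, SimpleGraph.edgeCount_comm G X Y, SimpleGraph.edgeCount_comm G Xᶜ Y,
      SimpleGraph.edgeCount_add_compl_right, Finset.sum_congr rfl fun v _ => hreg v]
    simp
  rcases le_or_gt Y.card X.card with hle | hlt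
  -- Here regularity and k ≤ D exclude a violation even if every pair is kept.
  · have hempty : badCut G T b k (X, Y) = ∅ := by
      rw [badCut, Finset.filter_eq_empty_iff]
      intro r _
      rw [not_lt]
      have h1 : hits (coins r) b ((Xᶜ ×ˢ Y).filter fun e => G.Adj e.1 e.2) ≤ N := by
        rw [hN, ← card_filter_adj, Finset.card_eq_sum_ones, hits]
        refine Finset.sum_le_sum fun e _ => ?_
        unfold hit
        split_ifs <;> omega
      obtain ⟨t, ht⟩ := Nat.exists_eq_add_of_le hle
      simp only
      rw [← hN']
      have h2 : t * k ≤ t * D := Nat.mul_le_mul_left t hkD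
      rw [ht] at hX ⊢
      rw [add_mul] at hX
      rw [mul_add, mul_comm k t]
      omega
    rw [hempty]
    simp only [Finset.card_empty, Nat.cast_zero]
    positivity
  · obtain ⟨t, ht⟩ := Nat.exists_eq_add_of_lt hlt
    have hNN : N = N' + (t + 1) * D := by
      rw [ht, add_assoc, add_mul] at hY
      omega
    set m := N' + k * (t + 1) + 1 with hm
    have hsub : badCut G T b k (X, Y) ⊆ Finset.univ.filter fun r : Fin T → Bool =>
        m ≤ hits (coins r) b ((Xᶜ ×ˢ Y).filter fun e => G.Adj e.1 e.2) := by
      intro r hr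
      simp only [badCut, Finset.mem_filter, Finset.mem_univ, true_and] at hr ⊢
      rw [ht, add_assoc, mul_add, ← hN'] at hr
      omega
    have h1 : ((badCut G T b k (X, Y)).card : ℝ) ≤
        2 ^ T * ((1 / 2) ^ m * Real.exp (N / 2 ^ b)) := by
      refine le_trans ?_ ((card_le_hits hT _ m).trans_eq (by rw [card_filter_adj (G := G)]))
      exact_mod_cast Finset.card_le_card hsub
    refine h1.trans (mul_le_mul_of_nonneg_left ?_ (by positivity))
    have hkN : (k : ℝ) * N ≤ D * m := by
      have e1 : k * N' ≤ D * N' := Nat.mul_le_mul_right _ hkD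
      have : k * N ≤ D * m := by
        calc k * N = k * N' + D * (k * (t + 1)) := by rw [hNN]; ring
          _ ≤ D * N' + D * (k * (t + 1)) + D := by omega
          _ = D * m := by rw [hm]; ring
      exact_mod_cast this
    have hD' : (0 : ℝ) < D := by exact_mod_cast hD
    have hn' : (0 : ℝ) < n := by exact_mod_cast hD.trans_le hDn
    have hDn' : (D : ℝ) ≤ n := by exact_mod_cast hDn
    have hdisc : (G.discrepancy X Y : ℝ) = N' + N := by
      rw [SimpleGraph.discrepancy_eq]; push_cast; rfl
    have hNr : (N : ℝ) = N' + (t + 1) * D := by exact_mod_cast hNN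
    have hN0 : (0 : ℝ) ≤ N' := Nat.cast_nonneg _
    have hm0 : (0 : ℝ) ≤ m := Nat.cast_nonneg _
    have hk0 : (0 : ℝ) ≤ k := Nat.cast_nonneg _
    have ht0 : (0 : ℝ) ≤ t * D := by positivity
    -- The mean is at most Nq/n = kN/(Ln), while m ≥ kN/D ≥ kN/n; the factor L ≥ 10 is the gap.
    have hexp : (N : ℝ) / 2 ^ b ≤ m / 10 := by
      have h2b : (0 : ℝ) < 2 ^ b := by positivity
      rw [div_le_div_iff₀ h2b (by norm_num)]
      have hkN' : (k : ℝ) * N ≤ n * m := hkN.trans (mul_le_mul_of_nonneg_right hDn' hm0)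
      have hb' : (n : ℝ) ≤ q * 2 ^ b := by exact_mod_cast hb
      have hkr : (k : ℝ) = L * q := by exact_mod_cast hk
      have hL' : (10 : ℝ) ≤ L := by exact_mod_cast hL
      have hq0 : (0 : ℝ) < q := by
        by_contra hc
        have : (q : ℝ) * 2 ^ b ≤ 0 := mul_nonpos_of_nonpos_of_nonneg (not_lt.1 hc) h2b.le
        linarith
      have h3 : (q : ℝ) * (N * 10) ≤ q * (m * 2 ^ b) := by
        calc (q : ℝ) * (N * 10) ≤ L * q * N := by
              have : 0 ≤ (q : ℝ) * N := by positivity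
              nlinarith
          _ = k * N := by rw [hkr]
          _ ≤ n * m := hkN'
          _ ≤ q * 2 ^ b * m := mul_le_mul_of_nonneg_right hb' hm0
          _ = _ := by ring
      exact le_of_mul_le_mul_left h3 hq0
    have hhalf : ((1 : ℝ) / 2) ^ m ≤ Real.exp (-(0.6 * m)) := by
      have h2 : (1 : ℝ) / 2 ≤ Real.exp (-0.6) := by
        rw [Real.exp_neg, ← one_div]
        refine one_div_le_one_div_of_le (Real.exp_pos _) ?_
        rw [← Real.le_log_iff_exp_le (by norm_num)]
        linarith [Real.log_two_gt_d9]
      calc ((1 : ℝ) / 2) ^ m ≤ Real.exp (-0.6) ^ m := pow_le_pow_left₀ (by norm_num) h2 _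
        _ = _ := by rw [← Real.exp_nat_mul]; ring_nf
    -- After multiplication by D, the terms on the left are at most kN/8 and kN/4, and kN ≤ Dm.
    have hgoal : (k : ℝ) / 8 + d * (k * γ / 256) ≤ m / 2 := by
      have h2 : (D : ℝ) * (k / 8 + d * (k * γ / 256)) ≤ D * (m / 2) := by
        have h3 := mul_le_mul_of_nonneg_left hd hk0
        have h4 : (k : ℝ) * D ≤ k * N := mul_le_mul_of_nonneg_left (by linarith) hk0
        have h5 : (k : ℝ) * N' ≤ k * N := mul_le_mul_of_nonneg_left (by linarith) hk0
        have h6 : (0 : ℝ) ≤ D * m := by positivity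
        rw [hdisc] at h3
        linarith
      exact le_of_mul_le_mul_left h2 hD'
    calc ((1 : ℝ) / 2) ^ m * Real.exp (N / 2 ^ b)
        ≤ Real.exp (-(0.6 * m)) * Real.exp (m / 10) :=
          mul_le_mul hhalf (Real.exp_le_exp.2 hexp) (Real.exp_pos _).le (Real.exp_pos _).le
      _ = Real.exp (-(m / 2)) := by rw [← Real.exp_add]; ring_nf
      _ ≤ Real.exp (-(k / 8) + d * (-(k * γ / 256))) := Real.exp_le_exp.2 (by linarith)
      _ = _ := by rw [Real.exp_add, Real.exp_nat_mul]

/-- Bounding each pair by the sum over all four centres avoids counting pairs at a given distance: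
the weights around one centre add up to (1 + τ)^(2n). -/
theorem sum_card_badCut_le {L q : ℕ} {γ : ℝ} (hT : n * n * b ≤ T) (hreg : ∀ v, G.degree v = D)
    (hD : 0 < D) (hkD : k ≤ D) (hDn : D ≤ n) (hk : k = L * q) (hL : 10 ≤ L)
    (hb : n ≤ q * 2 ^ b) (hγ : 0 ≤ γ)
    (hexp : ∀ S : Finset (Fin n), 2 * S.card ≤ n → γ * D * S.card ≤ G.edgeCount S Sᶜ) :
    ∑ p, ((badCut G T b k p).card : ℝ) ≤
      2 ^ T * (4 * Real.exp (-(k / 8)) * Real.exp (2 * n * Real.exp (-(k * γ / 256)))) := by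
  obtain ⟨X₀, Y₀, hcen⟩ := SimpleGraph.exists_centers (G := G) (c := γ * D) (by positivity)
    (by simpa using hexp)
  set C : Finset (Finset (Fin n) × Finset (Fin n)) :=
    {(∅, ∅), (Finset.univ, Finset.univ), (X₀, Y₀), (X₀ᶜ, Y₀ᶜ)} with hC
  have hcard : (C.card : ℝ) ≤ 4 := by rw [hC]; exact_mod_cast Finset.card_le_four
  clear_value C
  set τ := Real.exp (-(k * γ / 256)) with hτ
  have hτ0 : 0 < τ := Real.exp_pos _
  have hone : ∀ p, ((badCut G T b k p).card : ℝ) ≤ ∑ z ∈ C,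
      2 ^ T * (Real.exp (-(k / 8)) * τ ^ ((p.1 ∆ z.1).card + (p.2 ∆ z.2).card)) := by
    intro p
    obtain ⟨z, hz, hd⟩ := hcen p.1 p.2
    have h1 := card_badCut_le hT hreg hD hkD hDn hk hL hb p hd
    rw [← hτ] at h1
    refine h1.trans (Finset.single_le_sum (f := fun z : Finset (Fin n) × Finset (Fin n) =>
      (2 : ℝ) ^ T * (Real.exp (-(k / 8)) * τ ^ ((p.1 ∆ z.1).card + (p.2 ∆ z.2).card)))
      (fun z _ => ?_) hz)
    positivity
  calc ∑ p, ((badCut G T b k p).card : ℝ)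
      ≤ ∑ p : Finset (Fin n) × Finset (Fin n), ∑ z ∈ C, 2 ^ T * (Real.exp (-(k / 8)) *
        τ ^ ((p.1 ∆ z.1).card + (p.2 ∆ z.2).card)) := Finset.sum_le_sum fun p _ => hone p
    _ = C.card * (2 ^ T * (Real.exp (-(k / 8)) * (1 + τ) ^ (2 * n))) := by
      rw [Finset.sum_comm]
      simp only [← Finset.mul_sum, Finset.sum_pow_card_symmDiff, Fintype.card_fin,
        Finset.sum_const, nsmul_eq_mul]
      ring
    _ ≤ 4 * (2 ^ T * (Real.exp (-(k / 8)) * Real.exp (2 * n * τ))) := by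
      have h1 : (1 + τ) ^ (2 * n) ≤ Real.exp (2 * n * τ) := by
        have : Real.exp (2 * n * τ) = Real.exp τ ^ (2 * n) := by
          rw [← Real.exp_nat_mul]; push_cast; ring_nf
        rw [this]
        refine pow_le_pow_left₀ (by positivity) ?_ _
        linarith [Real.add_one_le_exp τ]
      gcongr
    _ = _ := by ring

/-- The coin sequences for which the set `S` does not expand. -/
def badSet (G : SimpleGraph (Fin n)) [DecidableRel G.Adj] (T b : ℕ) (S : Finset (Fin n)) :
    Finset (Fin T → Bool) :=
  Finset.univ.filter fun r =>
    hits (coins r) b ((S ×ˢ Sᶜ).filter fun e => G.Adj e.1 e.2) < S.card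

/-- At least α·n·|S| pairs leave S, each kept with probability at least q/(2n), so the lower tail is
at most ξ^|S|. Summing over nonempty S gives at most (1 + ξ)^n - 1 ≤ exp(nξ) - 1 ≤ 2nξ. -/
theorem sum_card_badSet_le {q : ℕ} {α : ℝ} (hT : n * n * b ≤ T) (hn : 0 < n)
    (hb : q * 2 ^ b ≤ 2 * n)
    (hexp : ∀ S : Finset (Fin n), 2 * S.card ≤ n → α * n * S.card ≤ G.edgeCount S Sᶜ)
    (hsmall : n * (2 * Real.exp (-(α * q / 4))) ≤ 1) :
    ∑ S ∈ Finset.univ.filter (fun S : Finset (Fin n) => 0 < S.card ∧ 2 * S.card ≤ n),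
      ((badSet G T b S).card : ℝ) ≤ 2 ^ T * (2 * (n * (2 * Real.exp (-(α * q / 4))))) := by
  set ξ := 2 * Real.exp (-(α * q / 4)) with hξ
  have hξ0 : 0 < ξ := by positivity
  have hn' : (0 : ℝ) < n := by exact_mod_cast hn
  have hone : ∀ S ∈ Finset.univ.filter (fun S : Finset (Fin n) => 0 < S.card ∧ 2 * S.card ≤ n),
      ((badSet G T b S).card : ℝ) ≤ 2 ^ T * ξ ^ S.card := by
    intro S hS
    simp only [Finset.mem_filter, Finset.mem_univ, true_and] at hS
    have h1 : ((badSet G T b S).card : ℝ) ≤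
        2 ^ T * (2 ^ S.card * Real.exp (-(G.edgeCount S Sᶜ / (2 * 2 ^ b)))) := by
      refine le_trans ?_ ((card_hits_le hT _ S.card).trans_eq (by rw [card_filter_adj (G := G)]))
      refine Nat.cast_le.2 (Finset.card_le_card fun r hr => ?_)
      simp only [badSet, Finset.mem_filter, Finset.mem_univ, true_and] at hr ⊢
      exact hr.le
    refine h1.trans (mul_le_mul_of_nonneg_left ?_ (by positivity))
    rw [hξ, mul_pow, ← Real.exp_nat_mul]
    refine mul_le_mul_of_nonneg_left (Real.exp_le_exp.2 ?_) (by positivity)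
    have h2 := hexp S hS.2
    have hb' : (q : ℝ) * 2 ^ b ≤ 2 * n := by exact_mod_cast hb
    have h3 : (S.card : ℝ) * (α * q / 4) ≤ G.edgeCount S Sᶜ / (2 * 2 ^ b) := by
      rw [le_div_iff₀ (by positivity)]
      rcases le_or_gt 0 α with hα | hα
      · have h4 : (S.card : ℝ) * α * (q * 2 ^ b) ≤ S.card * α * (2 * n) :=
          mul_le_mul_of_nonneg_left hb' (by positivity)
        nlinarith
      · have h4 : (S.card : ℝ) * (α * q / 4) * (2 * 2 ^ b) ≤ 0 := by
          have : 0 ≤ (S.card : ℝ) * (q * 2 ^ b) := by positivity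
          nlinarith
        exact h4.trans (Nat.cast_nonneg _)
    linarith
  refine (Finset.sum_le_sum hone).trans ?_
  rw [← Finset.mul_sum]
  refine mul_le_mul_of_nonneg_left ?_ (by positivity)
  have h1 : ∑ S ∈ Finset.univ.filter (fun S : Finset (Fin n) => 0 < S.card ∧ 2 * S.card ≤ n),
      ξ ^ S.card ≤ ∑ S ∈ (Finset.univ : Finset (Finset (Fin n))).erase ∅, ξ ^ S.card := by
    refine Finset.sum_le_sum_of_subset_of_nonneg (fun S hS => ?_) (fun _ _ _ => by positivity)
    simp only [Finset.mem_filter, Finset.mem_univ, true_and] at hS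
    simp only [Finset.mem_erase, Finset.mem_univ, and_true]
    exact (Finset.card_pos.1 hS.1).ne_empty
  have h2 := Finset.add_sum_erase Finset.univ (fun S : Finset (Fin n) => ξ ^ S.card)
    (Finset.mem_univ ∅)
  rw [Finset.sum_pow_card_univ, Fintype.card_fin, Finset.card_empty, pow_zero] at h2
  have h3 : (1 + ξ) ^ n ≤ Real.exp (n * ξ) := by
    rw [Real.exp_nat_mul]
    refine pow_le_pow_left₀ (by positivity) ?_ _
    linarith [Real.add_one_le_exp ξ]
  have h4 : |Real.exp (n * ξ) - 1| ≤ 2 * |n * ξ| := by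
    apply Real.abs_exp_sub_one_le
    rw [abs_of_nonneg (by positivity)]
    exact hsmall
  rw [abs_of_nonneg (a := (n : ℝ) * ξ) (by positivity)] at h4
  have h5 := le_abs_self (Real.exp (n * ξ) - 1)
  linarith

end RAM

/-! ### Choice of n₀ and translation of the hypotheses -/

/-- What is needed of `n`, where `L` is its bit length. -/
structure LargeEnough (β γ : ℝ) (n L : ℕ) : Prop where
  size : L = n.size
  two_le : 2 ≤ n
  ten_le : 10 ≤ L
  cube_le : ((L * (L * L) : ℕ) : ℝ) ≤ β * n
  square_le : L * L ≤ n
  sweeps : ((L * (L * L)) * (n + n) + 1) * ((n + n) * (n + n + 1)) < n ^ 5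
  cut : 4 * Real.exp (-((L * (L * L) : ℕ) / 8)) *
    Real.exp (2 * n * Real.exp (-((L * (L * L) : ℕ) * γ / 256))) ≤ 1 / (2 * n)
  expand : 2 * (n * (2 * Real.exp (-(β * γ * (L * L : ℕ) / 4)))) ≤ 1 / (2 * n)
  one_le_log : 1 ≤ Real.log n
  degree : ((L * (L * L) + L * (L * L) : ℕ) : ℝ) ≤ Real.log n ^ 4

theorem exists_largeEnough {β γ : ℝ} (hβ : 0 < β) (hγ : 0 < γ) :
    ∃ n₀ : ℕ, ∀ n ≥ n₀, LargeEnough β γ n n.size := by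
  -- The summands make log n at least 192, 512/γ, 12/(βγ) and 192/β; these bounds serve the degree
  -- and size estimates, the cut bound, the expansion bound and L³ ≤ βn.
  set K := 192 + 512 / γ + 12 / (β * γ) + 192 / β with hK
  have k1 : 0 < 512 / γ := by positivity
  have k2 : 0 < 12 / (β * γ) := by positivity
  have k3 : 0 < 192 / β := by positivity
  refine ⟨⌈Real.exp K⌉₊, fun n hn => ?_⟩
  have hexpn : Real.exp K ≤ n := (Nat.le_ceil _).trans (by exact_mod_cast hn)
  have hn0 : (0 : ℝ) < n := (Real.exp_pos K).trans_le hexpn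
  set l := Real.log n with hl
  have hKl : K ≤ l := (Real.le_log_iff_exp_le hn0).2 hexpn
  have hnl : (n : ℝ) = Real.exp l := (Real.exp_log hn0).symm
  have l1 : 192 ≤ l := by linarith
  have l2 : 512 ≤ γ * l := by
    have : 512 / γ ≤ l := by linarith
    rwa [div_le_iff₀ hγ, mul_comm] at this
  have l3 : 12 ≤ β * γ * l := by
    have : 12 / (β * γ) ≤ l := by linarith
    rwa [div_le_iff₀ (by positivity), mul_comm] at this
  have l4 : 192 ≤ β * l := by
    have : 192 / β ≤ l := by linarith
    rwa [div_le_iff₀ hβ, mul_comm] at this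
  have l0 : 0 < l := by linarith
  have hnat0 : 0 < n := by exact_mod_cast hn0
  set L := n.size with hL
  have hLlow : l ≤ L := by
    have h1 : (n : ℝ) ≤ 2 ^ L := by exact_mod_cast (Nat.lt_size_self n).le
    have h2 : l ≤ L * Real.log 2 := by
      rw [hl, ← Real.log_pow]
      exact Real.log_le_log hn0 h1
    have h3 : Real.log 2 ≤ 1 := by linarith [Real.log_two_lt_d9]
    have h4 : (0 : ℝ) ≤ L := Nat.cast_nonneg _
    nlinarith only [h2, h3, h4]
  have hLup : (L : ℝ) ≤ 2 * l := by
    have hLpos : 0 < L := Nat.size_pos.2 hnat0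
    obtain ⟨m, hm⟩ : ∃ m, L = m + 1 := ⟨L - 1, by omega⟩
    have h1 : 2 ^ m ≤ n := Nat.lt_size.1 (by omega)
    have h2 : m * Real.log 2 ≤ l := by
      rw [hl, ← Real.log_pow]
      exact Real.log_le_log (by positivity) (by exact_mod_cast h1)
    have h3 : (0.69 : ℝ) ≤ Real.log 2 := by linarith [Real.log_two_gt_d9]
    have h4 : (0 : ℝ) ≤ m := Nat.cast_nonneg _
    have h5 : (L : ℝ) = m + 1 := by rw [hm]; push_cast; ring
    nlinarith only [h2, h3, h4, h5, l1]
  have hL0 : (0 : ℝ) ≤ L := Nat.cast_nonneg _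
  have hq1 : l * l ≤ ((L * L : ℕ) : ℝ) := by
    rw [Nat.cast_mul]; exact mul_le_mul hLlow hLlow l0.le hL0
  have hq2 : ((L * L : ℕ) : ℝ) ≤ 4 * (l * l) := by
    rw [Nat.cast_mul]
    calc (L : ℝ) * L ≤ (2 * l) * (2 * l) := mul_le_mul hLup hLup hL0 (by positivity)
      _ = _ := by ring
  have hk1 : l * (l * l) ≤ ((L * (L * L) : ℕ) : ℝ) := by
    rw [Nat.cast_mul]; exact mul_le_mul hLlow hq1 (by positivity) hL0
  have hk2 : ((L * (L * L) : ℕ) : ℝ) ≤ 8 * (l * (l * l)) := by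
    rw [Nat.cast_mul]
    calc (L : ℝ) * ((L * L : ℕ) : ℝ) ≤ (2 * l) * (4 * (l * l)) :=
          mul_le_mul hLup hq2 (Nat.cast_nonneg _) (by positivity)
      _ = _ := by ring
  -- One term of the exponential series, l⁴/4! ≤ n, puts L³ ≤ 8l³ below both n and βn.
  have hfour : l * (l * (l * l)) ≤ 24 * n := by
    have := Real.pow_div_factorial_le_exp l l0.le 4
    rw [← hnl] at this
    norm_num [Nat.factorial] at this
    linarith
  have hll : 0 < l * (l * l) := by positivity
  have hkn : ((L * (L * L) : ℕ) : ℝ) ≤ n := by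
    have : 192 * (l * (l * l)) ≤ l * (l * (l * l)) := mul_le_mul_of_nonneg_right l1 hll.le
    linarith
  have hkn' : L * (L * L) ≤ n := by exact_mod_cast hkn
  have hLten : 10 ≤ L := by
    have : (10 : ℝ) ≤ L := by linarith
    exact_mod_cast this
  have hn20 : 20 ≤ n := by
    have h1 := Real.add_one_le_exp l
    rw [← hnl] at h1
    have : (20 : ℝ) ≤ n := by linarith
    exact_mod_cast this
  have hinv : 1 / (2 * (n : ℝ)) = Real.exp (-l) / 2 := by
    rw [Real.exp_neg, ← hnl]; field_simp
  have e24 : 24 ≤ Real.exp l := by linarith [Real.add_one_le_exp l]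
  refine ⟨rfl, by omega, hLten, ?_, ?_, ?_, ?_, ?_, by linarith, ?_⟩
  · have h1 : 192 * (l * (l * l)) ≤ (β * l) * (l * (l * l)) :=
      mul_le_mul_of_nonneg_right l4 hll.le
    have h2 := mul_le_mul_of_nonneg_left hfour hβ.le
    linarith
  · refine le_trans ?_ hkn'
    exact Nat.le_mul_of_pos_left _ (by omega)
  · calc ((L * (L * L)) * (n + n) + 1) * ((n + n) * (n + n + 1))
        ≤ (3 * (n * n)) * (6 * (n * n)) := by
          refine Nat.mul_le_mul ?_ ?_
          · have := Nat.mul_le_mul_right (n + n) hkn'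
            have h2 : 1 ≤ n * n := Nat.mul_pos hnat0 hnat0
            rw [mul_add n n n] at this
            omega
          · have h2 : n ≤ n * n := Nat.le_mul_of_pos_left _ hnat0
            have h3 : (n + n) * (n + n + 1) = 4 * (n * n) + 2 * n := by ring
            omega
      _ = 18 * n ^ 4 := by ring
      _ < n * n ^ 4 := Nat.mul_lt_mul_of_pos_right (by omega) (by positivity)
      _ = n ^ 5 := by ring
  · have h1 : (n : ℝ) * Real.exp (-((L * (L * L) : ℕ) * γ / 256)) ≤ 1 / 2 := by
      calc (n : ℝ) * Real.exp (-((L * (L * L) : ℕ) * γ / 256)) ≤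
            Real.exp l * Real.exp (-(2 * l)) := by
            rw [← hnl]
            refine mul_le_mul_of_nonneg_left (Real.exp_le_exp.2 ?_) hn0.le
            have h2 : 512 * (l * 1) ≤ (γ * l) * (l * l) :=
              mul_le_mul l2 (mul_le_mul_of_nonneg_left (by linarith) l0.le) (by positivity)
                (by positivity)
            have h3 := mul_le_mul_of_nonneg_right hk1 hγ.le
            linarith
        _ = Real.exp (-l) := by rw [← Real.exp_add]; ring_nf
        _ ≤ 1 / 2 := by
            rw [Real.exp_neg, ← one_div]
            exact one_div_le_one_div_of_le (by norm_num) (by linarith)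
    have h2 : Real.exp (2 * n * Real.exp (-((L * (L * L) : ℕ) * γ / 256))) ≤ 3 := by
      refine le_trans (Real.exp_le_exp.2 (show _ ≤ (1 : ℝ) by linarith)) ?_
      linarith [Real.exp_one_lt_d9]
    have h3 : Real.exp (-((L * (L * L) : ℕ) / 8)) ≤ Real.exp (-l) * Real.exp (-l) := by
      rw [← Real.exp_add]
      refine Real.exp_le_exp.2 ?_
      have : l * 16 ≤ l * (l * l) := mul_le_mul_of_nonneg_left (by nlinarith only [l1]) l0.le
      linarith only [this, hk1]
    have h4 : Real.exp (-l) ≤ 1 / 24 := by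
      rw [Real.exp_neg, ← one_div]
      exact one_div_le_one_div_of_le (by norm_num) e24
    have h5 := Real.exp_pos (-l)
    rw [hinv]
    calc 4 * Real.exp (-((L * (L * L) : ℕ) / 8)) *
          Real.exp (2 * n * Real.exp (-((L * (L * L) : ℕ) * γ / 256)))
        ≤ 4 * (Real.exp (-l) * Real.exp (-l)) * 3 :=
          mul_le_mul (by linarith) h2 (Real.exp_pos _).le (by positivity)
      _ ≤ Real.exp (-l) / 2 := by
          linarith only [mul_le_mul_of_nonneg_left h4 h5.le, h5]
  · have h3 : Real.exp (-(β * γ * (L * L : ℕ) / 4)) ≤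
        Real.exp (-l) * (Real.exp (-l) * Real.exp (-l)) := by
      rw [← Real.exp_add, ← Real.exp_add]
      refine Real.exp_le_exp.2 ?_
      have h1 : 12 * l ≤ (β * γ * l) * l := mul_le_mul_of_nonneg_right l3 l0.le
      have h2 := mul_le_mul_of_nonneg_left hq1 (show 0 ≤ β * γ by positivity)
      linarith
    have h4 : Real.exp (-l) ≤ 1 / 24 := by
      rw [Real.exp_neg, ← one_div]
      exact one_div_le_one_div_of_le (by norm_num) e24
    have h5 := Real.exp_pos (-l)
    have h6 : (n : ℝ) * Real.exp (-l) = 1 := by rw [hnl, ← Real.exp_add]; simp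
    rw [hinv]
    calc 2 * (n * (2 * Real.exp (-(β * γ * (L * L : ℕ) / 4))))
        ≤ 2 * (n * (2 * (Real.exp (-l) * (Real.exp (-l) * Real.exp (-l))))) := by gcongr
      _ = 4 * (n * Real.exp (-l)) * (Real.exp (-l) * Real.exp (-l)) := by ring
      _ = 4 * (Real.exp (-l) * Real.exp (-l)) := by rw [h6]; ring
      _ ≤ Real.exp (-l) / 2 := by
          linarith only [mul_le_mul_of_nonneg_left h4 h5.le, h5]
  · have h1 : 192 * (l * (l * l)) ≤ l * (l * (l * l)) := mul_le_mul_of_nonneg_right l1 hll.le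
    rw [Nat.cast_add]
    calc _ ≤ l * (l * (l * l)) := by linarith
      _ = l ^ 4 := by ring

/-- The expansion hypothesis in terms of edge counts. -/
theorem IsDenseRegularExpander.exists_degree {β γ : ℝ} {n : ℕ} {G : SimpleGraph (Fin n)}
    [DecidableRel G.Adj] (h : IsDenseRegularExpander β γ G) :
    ∃ D : ℕ, (∀ v, G.degree v = D) ∧ β * n ≤ D ∧ ∀ S : Finset (Fin n), 2 * S.card ≤ n →
      γ * D * S.card ≤ G.edgeCount S Sᶜ := by
  obtain ⟨D, h1, h2, h3⟩ := h
  refine ⟨D, fun v => ?_, h2, fun S hS => ?_⟩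
  · rw [← h1 v]
    congr!
  · rcases Nat.eq_zero_or_pos S.card with h0 | h0
    · simp only [h0, Nat.cast_zero, mul_zero]
      exact Nat.cast_nonneg _
    have hcut : (WeightedGraph.ofSimpleGraph G).cutWeight S = G.edgeCount S Sᶜ := by
      simp only [WeightedGraph.cutWeight, WeightedGraph.ofSimpleGraph, SimpleGraph.edgeCount]
      push_cast
      refine Finset.sum_congr rfl fun u _ => Finset.sum_congr rfl fun v _ => ?_
      by_cases huv : G.Adj u v <;> simp [huv]
    have h4 : (WeightedGraph.ofSimpleGraph G).edgeExpansion ≤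
        (WeightedGraph.ofSimpleGraph G).cutWeight S / S.card := by
      refine csInf_le ⟨0, ?_⟩ ⟨S, h0, by simpa using hS, rfl⟩
      rintro x ⟨S', -, -, rfl⟩
      refine div_nonneg (Finset.sum_nonneg fun u _ => Finset.sum_nonneg fun v _ =>
        WeightedGraph.nonneg _ _ _) (Nat.cast_nonneg _)
    have h5 := h3.trans h4
    rwa [le_div_iff₀ (by exact_mod_cast h0), hcut] at h5

/-! ### Success probability of the algorithm -/

namespace RAM

open Polynomial in
/-- A bound for the number of steps and the number of coins of `mainProg`. -/
noncomputable def mainBound : ℕ[X] := mainCost + X ^ 3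

-- Bad cuts and non-expanding sets each account for a fraction of at most 1/(2n) of the coin
-- sequences. Every other sequence leads push–relabel to line sums k and keeps the expansion of R,
-- because the flow only adds entries.
open Classical in
theorem mainProg_success {β γ : ℝ} {n : ℕ} {G : SimpleGraph (Fin n)} (hβ : 0 < β) (hγ : 0 < γ)
    (hn : LargeEnough β γ n n.size) (hG : IsDenseRegularExpander β γ G) :
    (1 - 1 / (n : ℝ)) * 2 ^ (mainBound.eval n) ≤
      ((Finset.univ.filter fun r : Fin (mainBound.eval n) → Bool =>
        ∃ (t : ℕ) (s : State) (H : WeightedGraph (Fin n)),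
          Run (coins r) mainProg (State.input G) t s ∧ s.Outputs H ∧
          IsSparseExpandingSubgraph (Real.log n ^ (4 / (β * γ ^ 2))) G H).card : ℝ) := by
  set L := n.size with hL
  set q := L * L with hq
  set k := L * q with hk
  set b := (n / q).size with hb
  set T := mainBound.eval n with hT
  obtain ⟨D, hreg, hDβ, hexp⟩ := hG.exists_degree
  have hn0 : 0 < n := by have := hn.two_le; omega
  have hn0' : (0 : ℝ) < n := by exact_mod_cast hn0
  have hDpos : (0 : ℝ) < D := lt_of_lt_of_le (by positivity) hDβ
  have hD : 0 < D := by exact_mod_cast hDpos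
  have hDn : D ≤ n := by
    rw [← hreg ⟨0, hn0⟩]
    exact (G.degree_lt_card_verts _).le.trans_eq (by simp)
  have hDn' : (D : ℝ) ≤ n := by exact_mod_cast hDn
  have hkD : k ≤ D := by
    have : (k : ℝ) ≤ D := hn.cube_le.trans hDβ
    exact_mod_cast this
  have hβ1 : β ≤ 1 := by
    have : β * n ≤ 1 * n := by linarith
    exact le_of_mul_le_mul_right this hn0'
  have hγ1 : γ ≤ 1 := by
    have h1 := hexp {⟨0, hn0⟩} (by simpa using hn.two_le)
    have h2 : G.edgeCount {⟨0, hn0⟩} {⟨0, hn0⟩}ᶜ ≤ D := by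
      have := G.edgeCount_add_compl_right {⟨0, hn0⟩} {⟨0, hn0⟩}
      rw [Finset.sum_singleton, hreg] at this
      omega
    have h3 : (G.edgeCount {⟨0, hn0⟩} {⟨0, hn0⟩}ᶜ : ℝ) ≤ D := by exact_mod_cast h2
    simp only [Finset.card_singleton, Nat.cast_one, mul_one] at h1
    have : γ * D ≤ 1 * D := by linarith
    exact le_of_mul_le_mul_right this hDpos
  -- Since β, γ ≤ 1 and log n ≥ 1, the fourth power is at most the power 4/(βγ²).
  have hdeg : ((k + k : ℕ) : ℝ) ≤ Real.log n ^ (4 / (β * γ ^ 2)) := by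
    refine hn.degree.trans ?_
    rw [← Real.rpow_natCast]
    refine Real.rpow_le_rpow_of_exponent_le hn.one_le_log ?_
    rw [le_div_iff₀ (by positivity)]
    have h1 : β * γ ^ 2 ≤ 1 * 1 :=
      mul_le_mul hβ1 (pow_le_one₀ hγ.le hγ1) (by positivity) (by norm_num)
    push_cast
    linarith
  have hLpos : 0 < L := by have := hn.ten_le; omega
  have hqpos : 0 < q := Nat.mul_pos hLpos hLpos
  have hqn : q ≤ n := hn.square_le
  have hbn : b ≤ n := by
    rw [hb, Nat.size_le]
    exact (Nat.div_le_self _ _).trans_lt Nat.lt_two_pow_self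
  have hb1 : n ≤ q * 2 ^ b := by
    have := Nat.lt_size_self (n / q)
    rw [← hb, Nat.div_lt_iff_lt_mul hqpos, mul_comm] at this
    exact this.le
  have hb2 : q * 2 ^ b ≤ 2 * n := by
    have h1 : 0 < n / q := Nat.div_pos hqn hqpos
    obtain ⟨m, hm⟩ : ∃ m, b = m + 1 := ⟨b - 1, by have := Nat.size_pos.2 h1; omega⟩
    have h2 : 2 ^ m ≤ n / q := Nat.lt_size.1 (by omega)
    rw [Nat.le_div_iff_mul_le hqpos] at h2
    rw [hm, pow_succ]
    linarith
  -- The summand X³ in the bound guarantees that T coins cover all n² blocks.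
  have hTb : n * n * b ≤ T := by
    rw [hT, mainBound, Polynomial.eval_add, Polynomial.eval_pow, Polynomial.eval_X]
    calc n * n * b ≤ n * n * n := Nat.mul_le_mul_left _ hbn
      _ = n ^ 3 := by ring
      _ ≤ _ := Nat.le_add_left _ _
  have hbad1 := sum_card_badCut_le (G := G) (T := T) (b := b) (k := k) (L := L) (q := q) hTb hreg hD
    hkD hDn hk hn.ten_le hb1 hγ.le hexp
  have hbad2 := sum_card_badSet_le (G := G) (T := T) (b := b) (q := q) (α := β * γ) hTb hn0 hb2
    (fun S hS => by
      refine le_trans (mul_le_mul_of_nonneg_right ?_ (Nat.cast_nonneg _)) (hexp S hS)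
      calc β * γ * n = γ * (β * n) := by ring
        _ ≤ γ * D := mul_le_mul_of_nonneg_left hDβ hγ.le)
    (by
      have h1 := hn.expand
      have h2 : 1 / (2 * (n : ℝ)) ≤ 1 := by
        rw [div_le_one (by positivity)]
        have : (2 : ℝ) ≤ n := by exact_mod_cast hn.two_le
        linarith
      linarith)
  set bad : Finset (Fin T → Bool) := (Finset.univ.biUnion (badCut G T b k)) ∪
    ((Finset.univ.filter (fun S : Finset (Fin n) => 0 < S.card ∧ 2 * S.card ≤ n)).biUnion
      (badSet G T b)) with hbad
  have hbadcard : (bad.card : ℝ) ≤ 2 ^ T * (1 / n) := by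
    have h1 : bad.card ≤ ∑ p, (badCut G T b k p).card +
        ∑ S ∈ Finset.univ.filter (fun S : Finset (Fin n) => 0 < S.card ∧ 2 * S.card ≤ n),
          (badSet G T b S).card :=
      (Finset.card_union_le _ _).trans (add_le_add Finset.card_biUnion_le Finset.card_biUnion_le)
    have h2 : (bad.card : ℝ) ≤ ∑ p, ((badCut G T b k p).card : ℝ) +
        ∑ S ∈ Finset.univ.filter (fun S : Finset (Fin n) => 0 < S.card ∧ 2 * S.card ≤ n),
          ((badSet G T b S).card : ℝ) := by exact_mod_cast h1
    have hpow : (0 : ℝ) ≤ 2 ^ T := by positivity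
    have h3 := mul_le_mul_of_nonneg_left hn.cut hpow
    have h4 := mul_le_mul_of_nonneg_left hn.expand hpow
    have h5 : (1 : ℝ) / n = 1 / (2 * n) + 1 / (2 * n) := by field_simp; norm_num
    rw [h5, mul_add]
    linarith
  have hsub : badᶜ ⊆ Finset.univ.filter fun r : Fin T → Bool =>
      ∃ (t : ℕ) (s : State) (H : WeightedGraph (Fin n)),
        Run (coins r) mainProg (State.input G) t s ∧ s.Outputs H ∧
        IsSparseExpandingSubgraph (Real.log n ^ (4 / (β * γ ^ 2))) G H := by
    intro r hr
    simp only [hbad, Finset.mem_compl, Finset.mem_union, Finset.mem_biUnion, Finset.mem_univ,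
      true_and, not_or, not_exists, Finset.mem_filter, not_and] at hr ⊢
    obtain ⟨hr1, hr2⟩ := hr
    set R := sample (coins r) n b (adjMat G) with hR
    have hRA : ∀ i j : Fin n, R i j ≤ adjMat G i j := by
      intro i j
      simp only [hR, sample, hit]
      split_ifs <;> simp
    obtain ⟨m1, m2, m3⟩ := finalNet_spec (G := G) (k := k) (R := R) hRA (by
      intro X Y
      have := hr1 (X, Y)
      simp only [badCut, Finset.mem_filter, Finset.mem_univ, true_and, not_lt] at this
      rw [hR, sum_sample, sum_adjMat]
      exact this) hn.sweeps
    obtain ⟨t, s, hrun, -, hout⟩ := mainProg_spec (ω := coins r) hn0 G hL hq hk hR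
    refine ⟨t, s, symGraph G _ m1, hrun, ?_, ?_⟩
    · intro u v
      rw [hout u u.2 v v.2]
      rfl
    · refine symGraph_isSparseExpandingSubgraph hn.two_le m1 m2 m3 ?_ hdeg
      intro S hS1 hS2
      have := hr2 S ⟨hS1, hS2⟩
      simp only [badSet, Finset.mem_filter, Finset.mem_univ, true_and, not_lt] at this
      rw [← sum_sample (G := G)] at this
      exact this.trans (Finset.sum_le_sum fun i _ => Finset.sum_le_sum fun j _ =>
        Nat.le_add_right _ _)
  have hfinal : (badᶜ.card : ℝ) = 2 ^ T - bad.card := by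
    rw [Finset.card_compl, Nat.cast_sub (Finset.card_le_univ _)]
    simp
  calc (1 - 1 / (n : ℝ)) * 2 ^ T ≤ badᶜ.card := by rw [hfinal]; linarith
    _ ≤ _ := by exact_mod_cast Finset.card_le_card hsub

end RAM

theorem mainTheorem2 :
    ∃ C : ℝ, 0 < C ∧ ∀ β γ : ℝ, 0 < β → 0 < γ → ∃ n₀ : ℕ,
      (∀ n : ℕ, n₀ ≤ n → ∀ G : SimpleGraph (Fin n), IsDenseRegularExpander β γ G →
        ∃ H : WeightedGraph (Fin n),
          IsSparseExpandingSubgraph (Real.log n ^ (C / (β * γ ^ 2))) G H) ∧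
      RAM.SolvableInRandomizedPolyTime
        (fun n G => n₀ ≤ n ∧ IsDenseRegularExpander β γ G)
        (fun n G H => IsSparseExpandingSubgraph (Real.log n ^ (C / (β * γ ^ 2))) G H) := by
  classical
  refine ⟨4, by norm_num, fun β γ hβ hγ => ?_⟩
  obtain ⟨n₀, hn₀⟩ := exists_largeEnough hβ hγ
  refine ⟨n₀, fun n hn G hG => ?_, RAM.mainProg, RAM.mainBound, fun n G hG => ⟨fun ω => ?_, ?_⟩⟩
  -- Probabilistic method: n ≥ 2 makes the success probability positive, so some coin sequence
  -- produces H.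
  · have h1 := RAM.mainProg_success hβ hγ (hn₀ n hn) hG
    have h2 : (0 : ℝ) < (1 - 1 / (n : ℝ)) * 2 ^ (RAM.mainBound.eval n) := by
      have h3 : (2 : ℝ) ≤ n := by exact_mod_cast (hn₀ n hn).two_le
      have h4 : 1 / (n : ℝ) < 1 := by rw [div_lt_one (by linarith)]; linarith
      exact mul_pos (by linarith) (by positivity)
    have h5 := h2.trans_le h1
    rw [Nat.cast_pos, Finset.card_pos] at h5
    obtain ⟨r, hr⟩ := h5
    obtain ⟨-, t, s, H, -, -, hH⟩ := Finset.mem_filter.1 hr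
    exact ⟨H, hH⟩
  · have hn : 0 < n := by have := (hn₀ n hG.1).two_le; omega
    obtain ⟨t, s, hrun, ht, -⟩ := RAM.mainProg_spec (ω := ω) hn G rfl rfl rfl rfl
    refine ⟨t, s, hrun, ht.trans ?_⟩
    rw [RAM.mainBound, Polynomial.eval_add]
    exact Nat.le_add_right _ _
  · exact RAM.mainProg_success hβ hγ (hn₀ n hG.1) hG.2
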